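/- Fix $\alpha\in\mathbb N$, $\lambda^\ell,\lambda^r\in(0,1]$, $\rho^\ell,\rho^r\in(0,\alpha)$, $\theta<1$ and $T>0$. For $N\ge 1$ let $\Lambda_N=\{1,\dots,N-1\}$ and let $(\eta_t)_{t\ge0}$ be the Markov chain SEP($\alpha$) on $\Omega_N=\{0,\dots,\alpha\}^{\Lambda_N}$ with generator $\mathcal L_N=\mathcal L_{\rm bulk}+N^{-\theta}(\mathcal L_\ell+\mathcal L_r)$, where $$\mathcal L_{\rm bulk}f(\eta)=\sum_{x=1}^{N-2}\Big(\eta(x)(\alpha-\eta(x+1))[f(\eta+\delta_{x+1}-\delta_x)-f(\eta)]+\eta(x+1)(\alpha-\eta(x))[f(\eta+\delta_x-\delta_{x+1})-f(\eta)]\Big),$$ $$\mathcal L_jf(\eta)=\lambda^j\rho^j(\alpha-\eta(x^j))[f(\eta+\delta_{x^j})-f(\eta)]+\lambda^j(\alpha-\rho^j)\eta(x^j)[f(\eta-\delta_{x^j})-f(\eta)],\quad j\in\{\ell,r\},$$ with $x^\ell=1$, $x^r=N-1$ and $\delta_x$ the configuration with a single particle, at $x$ (terms with zero rate are read as $0$).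 Let $\mu^N$ be probability measures on $\Omega_N$, let $\mathbb E_{\mu^N}$ be the expectation for the chain started from $\mu^N$, and put, for $x,y\in\Lambda_N$ with $x\neq y$, $$\rho^N_t(x)=\mathbb E_{\mu^N}[\eta_{tN^2}(x)],\qquad \varphi^N_t(x,y)=\mathbb E_{\mu^N}\big[(\eta_{tN^2}(x)-\rho^N_t(x))(\eta_{tN^2}(y)-\rho^N_t(y))\big].$$ Let $x\mapsto a_Nx+b_N$ be the stationary affine density profile, that is $$a_N=\frac{\lambda^\ell\lambda^r(\rho^r-\rho^\ell)}{D_N},\quad b_N=\frac{\lambda^r\rho^r(N^\theta-\lambda^\ell)+\lambda^\ell\rho^\ell(N^\theta+(N-1)\lambda^r)}{D_N},\quad D_N=\lambda^\ell\lambda^r(N-1)+\lambda^\ell N^\theta+\lambda^r(N^\theta-\lambda^\ell).$$ Assume, with implicit constants independent of $N$: (i) there are $g_N\in C^6([0,1])$, $N\ge1$, with $\sup_N\sup_{u\in[0,1]}|g_N'(u)|<\infty$, such that $\partial_u^jg_N(u)=\partial_u^j(Na_Nu+b_N)$ for $u\in\{0,1\}$ and $j=0,1,2,3$, and $\max_{x\in\Lambda_N}|\rho^N_0(x)-g_N(x/N)|\lesssim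 1/N$; (ii) $\max_{x\ne y}|\varphi^N_0(x,y)|\lesssim 1/N$ and $\max_{x\in\Lambda_N\setminus\{1,N-1\}}\big|\mathbb E_{\mu^N}[\alpha\eta_0(x)(\eta_0(x)-1)-(\alpha-1)\rho^N_0(x)^2]\big|\lesssim 1/N$. Then there is a constant $C$, independent of $N$, $\epsilon$ and $t$, such that for every $\epsilon>0$ and every $t\in(0,T]$ $$\max_{\substack{x\in\Lambda_N,\ x\le\epsilon(N-1)\\ y\in\Lambda_N,\ y\ne x}}|\varphi^N_t(x,y)|\le C\Big(1+\frac1{\sqrt t}\Big)\frac{\epsilon}{N}+o\Big(\frac1N\Big)\qquad(N\to\infty),$$ where the $o(1/N)$ term may depend on $\epsilon$ and $t$, and the same bound holds for the maximum over $x,y\in\Lambda_N$ with $y\ge N-1-\epsilon(N-1)$ and $x\neq y$. -/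

import Mathlib

namespace SEP

/-- The parameters of the model: `α` is the maximal number of particles per site, `lamL, lamR` are
the intensities and `rhoL, rhoR` the densities of the left and right reservoirs, and `θ` tunes the
strength `N ^ (-θ)` of the boundary dynamics. -/
structure Params where
  α : ℕ
  lamL : ℝ
  lamR : ℝ
  rhoL : ℝ
  rhoR : ℝ
  θ : ℝ

/-- The admissible parameters: `α ≥ 1`, `0 < λ ≤ 1` and `0 < ρ < α` at both reservoirs. -/
structure Params.Admissible (p : Params) : Prop where
  one_le_α : 1 ≤ p.α
  lamL_mem : p.lamL ∈ Set.Ioc (0 : ℝ) 1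
  lamR_mem : p.lamR ∈ Set.Ioc (0 : ℝ) 1
  rhoL_mem : p.rhoL ∈ Set.Ioo (0 : ℝ) p.α
  rhoR_mem : p.rhoR ∈ Set.Ioo (0 : ℝ) p.α

/-- The bulk `{1, …, N - 1}`. -/
abbrev Site (N : ℕ) : Type := {x : ℕ // x ∈ Finset.Icc 1 (N - 1)}

/-- The configurations `{0, …, α} ^ {1, …, N - 1}`. -/
abbrev Config (α N : ℕ) : Type := Site N → Fin (α + 1)

/-- The occupation variable `η(x)`, as a real number. -/
def occ {α N : ℕ} (η : Config α N) (x : Site N) : ℝ := ((η x : ℕ) : ℝ)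

/-- The configuration `δ_x` with exactly one particle, at `x`. -/
def delta {α N : ℕ} (x : Site N) : Config α N := Pi.single x 1

/-- The bulk generator. Addition in `Fin (α + 1)` is modulo `α + 1`, so `η + δ_y - δ_x` is always
a configuration; it is the intended one whenever a particle can jump from `x` to `y`, and
otherwise the rate in front of it vanishes. -/
noncomputable def genBulk {α N : ℕ} (f : Config α N → ℝ) (η : Config α N) : ℝ :=
  ∑ x : Site N, ∑ y : Site N,
    if (y : ℕ) = x + 1 then
      occ η x * (α - occ η y) * (f (η + delta y - delta x) - f η)
        + occ η y * (α - occ η x) * (f (η + delta x - delta y) - f η)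
    else 0

/-- The generator of a reservoir of intensity `lam` and density `rho` acting on the site `x`. -/
noncomputable def genReservoir {α N : ℕ} (lam rho : ℝ) (x : Site N)
    (f : Config α N → ℝ) (η : Config α N) : ℝ :=
  lam * rho * (α - occ η x) * (f (η + delta x) - f η)
    + lam * (α - rho) * occ η x * (f (η - delta x) - f η)

/-- The generator of SEP(`α`) with slow/fast reservoirs: the bulk dynamics plus `N ^ (-θ)` times
the left reservoir acting on the site `1` and the right reservoir acting on the site `N - 1`. -/
noncomputable def gen (p : Params) (N : ℕ) (f : Config p.α N → ℝ) (η : Config p.α N) : ℝ :=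
  genBulk f η
    + 1 / (N : ℝ) ^ p.θ *
      ((∑ x : Site N, if (x : ℕ) = 1 then genReservoir p.lamL p.rhoL x f η else 0)
        + ∑ x : Site N, if (x : ℕ) = N - 1 then genReservoir p.lamR p.rhoR x f η else 0)

/-- The matrix of the generator: the entry at `(η, ξ)` is `gen` of the indicator of `ξ`, at `η`. -/
noncomputable def genMatrix (p : Params) (N : ℕ) :
    Matrix (Config p.α N) (Config p.α N) ℝ :=
  Matrix.of fun η ξ => gen p N (Pi.single ξ 1) η

/-- The transition matrix `exp (t N² L)`, at the macroscopic time `t`, of the Markov chain with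
generator `L` speeded up by `N²`. -/
noncomputable def transition (p : Params) (N : ℕ) (t : ℝ) :
    Matrix (Config p.α N) (Config p.α N) ℝ :=
  NormedSpace.exp ((t * (N : ℝ) ^ 2) • genMatrix p N)

/-- The expectation of `f` of the configuration at time `t N²`, for the chain started from `μ`. -/
noncomputable def expect (p : Params) (N : ℕ) (μ : MeasureTheory.Measure (Config p.α N))
    (t : ℝ) (f : Config p.α N → ℝ) : ℝ :=
  ∫ η, (transition p N t).mulVec f η ∂μ

/-- The expected density of particles `ρ_t^N(x)`. -/
noncomputable def density (p : Params) (N : ℕ) (μ : MeasureTheory.Measure (Config p.α N))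
    (t : ℝ) (x : Site N) : ℝ :=
  expect p N μ t fun η => occ η x

/-- The two-point correlation function `φ_t^N(x, y)` (used for `x ≠ y`): the expectation at time
`t N²` of the product of the centred occupation variables at `x` and `y`. -/
noncomputable def corr (p : Params) (N : ℕ) (μ : MeasureTheory.Measure (Config p.α N))
    (t : ℝ) (x y : Site N) : ℝ :=
  expect p N μ t fun η =>
    (occ η x - density p N μ t x) * (occ η y - density p N μ t y)

/-- The slope `a_N` of the stationary solution `x ↦ a_N x + b_N` of the discrete heat equation
satisfied by the density. It equals `λ^ℓ (b_N - ρ^ℓ) / (N^θ - λ^ℓ)` when `N^θ ≠ λ^ℓ`. -/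
noncomputable def slope (p : Params) (N : ℕ) : ℝ :=
  p.lamL * p.lamR * (p.rhoR - p.rhoL) /
    (p.lamL * p.lamR * ((N : ℝ) - 1) + p.lamL * (N : ℝ) ^ p.θ
      + p.lamR * ((N : ℝ) ^ p.θ - p.lamL))

/-- The intercept `b_N` of the stationary solution. -/
noncomputable def intercept (p : Params) (N : ℕ) : ℝ :=
  (p.lamR * p.rhoR * ((N : ℝ) ^ p.θ - p.lamL)
      + p.lamL * p.rhoL * ((N : ℝ) ^ p.θ + ((N : ℝ) - 1) * p.lamR)) /
    (p.lamL * p.lamR * ((N : ℝ) - 1) + p.lamL * (N : ℝ) ^ p.θ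
      + p.lamR * ((N : ℝ) ^ p.θ - p.lamL))

/-- Regularity of the initial density: it is `O(1/N)`-close to profiles `g_N` of class `C⁶` on
`[0, 1]`, with first derivatives bounded uniformly in `N`, whose derivatives of order `0, …, 3` at
the end points `0` and `1` are those of the stationary profile `u ↦ N a_N u + b_N`. -/
def RegularInitialDensity (p : Params)
    (μ : ∀ N : ℕ, MeasureTheory.Measure (Config p.α N)) : Prop :=
  ∃ g : ℕ → ℝ → ℝ,
    (∀ N, 1 ≤ N → ContDiffOn ℝ 6 (g N) (Set.Icc 0 1)) ∧
    (∃ K : ℝ, ∀ N, 1 ≤ N → ∀ u ∈ Set.Icc (0 : ℝ) 1,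
      |derivWithin (g N) (Set.Icc 0 1) u| ≤ K) ∧
    (∀ N, 1 ≤ N → ∀ u ∈ ({0, 1} : Set ℝ), ∀ j ≤ 3,
      iteratedDerivWithin j (g N) (Set.Icc 0 1) u
        = iteratedDeriv j (fun v : ℝ => (N : ℝ) * slope p N * v + intercept p N) u) ∧
    (∃ K : ℝ, ∀ N, 1 ≤ N → ∀ x : Site N,
      |density p N (μ N) 0 x - g N ((x : ℝ) / N)| ≤ K / N)

/-- Decay in the bulk of the correlations at time `0`: the off-diagonal correlations, and, away
from the sites `1` and `N - 1`, their diagonal counterparts, are of order `1/N`. -/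
def InitialCorrDecay (p : Params)
    (μ : ∀ N : ℕ, MeasureTheory.Measure (Config p.α N)) : Prop :=
  (∃ K : ℝ, ∀ N, 1 ≤ N → ∀ x y : Site N, x ≠ y → |corr p N (μ N) 0 x y| ≤ K / N) ∧
  (∃ K : ℝ, ∀ N, 1 ≤ N → ∀ x : Site N, (x : ℕ) ≠ 1 → (x : ℕ) ≠ N - 1 →
    |expect p N (μ N) 0 fun η =>
        p.α * (occ η x * (occ η x - 1)) - (p.α - 1) * density p N (μ N) 0 x ^ 2| ≤ K / N)

/-- `x` lies in the strip `{1, …, ε(N - 1)}` near the left boundary. -/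
def NearLeft {N : ℕ} (ε : ℝ) (x : Site N) : Prop := (x : ℝ) ≤ ε * ((N : ℝ) - 1)

/-- `y` lies in the strip `{N - 1 - ε(N - 1), …, N - 1}` near the right boundary. -/
def NearRight {N : ℕ} (ε : ℝ) (y : Site N) : Prop :=
  (N : ℝ) - 1 - ε * ((N : ℝ) - 1) ≤ (y : ℝ)

end SEP

/-! ### Maximum principle and linear systems of differential equations. -/

namespace SEP

open Set

/-! The correlations are part of a closed linear system. SEP(`α`) is self-dual: take `η(x) η(y)` off
the diagonal and `α η(x) (η(x) - 1) / (α - 1)` on it. The expectation of this function minus `ρ(x)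
ρ(y)`, called `pairCorr`, evolves by the generator of two dual particles killed at the reservoirs,
with source `-(ρ(x+1) - ρ(x))²` on neighbouring pairs only; the boundary inhomogeneities cancel
(`gen_pairDual`, `isPairFlow_pairCorr`). Since the discrete gradient of a solution of the heat
equation obeys a maximum principle, the gradient of the density stays `O(1/N)`
(`abs_density_sub_le`), and the source is `O(1/N²)`.

The system has a maximum principle, so an explicit supersolution bounds its solution
(`IsPairFlow.le_left`). It is a sum of three terms, one for each origin of correlations: (a) Initial
values of size `1/N` are multiplied by the probability that the left particle survives. An
exponential profile bounds it by a multiple of `(x + 1/κL) / (N √t)`, where `κL` is the killing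
intensity (`pairGen_survival_le`). (b) The source is absorbed by the product `(x + 1/κL) (N - y +
1/κR)`, a supersolution of the Green problem for neighbouring pairs (`pairGen_green_le`). (c) At the
corners `(1, 1)` and `(N-1, N-1)` the initial value is only `O(1)`. On products `f ⊗ f` with `f ≥ 0`
the dual pair is dominated by two independent reflected walks (`pairGen_tensor_le`), so a corner
contributes the square of a reflected heat kernel. That kernel is `O(N^(-3/4))` at fixed positive
macroscopic time (`exists_reflected_kernel`, `exists_scale`), hence the square is `o(1/N)`.

For `x ≤ ε N` the first two terms give `(1 + 1/√t) ε/N` plus a multiple of `(1/κL) / N²`. As `1/κL`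
is of order `N^θ` and `θ < 1`, the latter is `o(1/N)`. The right boundary follows by the reflection
`x ↦ N - x`. -/

/-- Maximum principle for finite systems of differential inequalities: a family that starts
nonnegative stays nonnegative if its time derivative is nonnegative at negative minima. -/
theorem nonneg_of_deriv_nonneg_at_min {ι : Type*} (I : Finset ι) {T : ℝ} (u u' : ℝ → ι → ℝ)
    (hd : ∀ s ∈ Icc 0 T, ∀ i ∈ I, HasDerivAt (fun r => u r i) (u' s i) s)
    (h0 : ∀ i ∈ I, 0 ≤ u 0 i)
    (hmin : ∀ s ∈ Icc 0 T, ∀ i ∈ I, u s i < 0 → (∀ j ∈ I, u s i ≤ u s j) → 0 ≤ u' s i) :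
    ∀ s ∈ Icc 0 T, ∀ i ∈ I, 0 ≤ u s i := by
  -- The perturbation `ε (1 + s)` makes the inequality strict. At the first time a component touches
  -- zero its left slopes are nonpositive, so `u' + ε ≤ 0`, against `0 ≤ u'` at a negative minimum.
  have key : ∀ ε : ℝ, 0 < ε → ∀ s ∈ Icc 0 T, ∀ i ∈ I, 0 < u s i + ε * (1 + s) := by
    intro ε hε
    by_contra hcon
    push Not at hcon
    let B : Set ℝ := ⋃ i ∈ I, {s ∈ Icc (0 : ℝ) T | u s i + ε * (1 + s) ≤ 0}
    have hBne : B.Nonempty := by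
      obtain ⟨s, hs, i, hi, h⟩ := hcon
      exact ⟨s, mem_biUnion hi ⟨hs, h⟩⟩
    have hcont : ∀ i ∈ I, ContinuousOn (fun s => u s i + ε * (1 + s)) (Icc 0 T) := by
      intro i hi s hs
      have := (hd s hs i hi).continuousAt.continuousWithinAt (s := Icc 0 T)
      exact this.add (by fun_prop)
    have hBcl : IsClosed B := by
      refine isClosed_biUnion_finset fun i hi => ?_
      exact (hcont i hi).preimage_isClosed_of_isClosed isClosed_Icc isClosed_Iic
    have hBbdd : BddBelow B := by
      refine ⟨0, fun s hs => ?_⟩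
      obtain ⟨i, _, h⟩ := mem_iUnion₂.1 hs
      exact h.1.1
    have hmem := hBcl.csInf_mem hBne hBbdd
    set σ := sInf B with hσ
    obtain ⟨i, hi, hσT, hle⟩ := mem_iUnion₂.1 hmem
    have hpos : ∀ s ∈ Icc 0 T, s < σ → ∀ j ∈ I, 0 < u s j + ε * (1 + s) := by
      intro s hs hlt j hj
      by_contra hneg
      exact absurd (csInf_le hBbdd (mem_biUnion hj ⟨hs, not_lt.1 hneg⟩)) (not_le.2 hlt)
    have hσ0 : 0 < σ := by
      rcases hσT.1.lt_or_eq with h | h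
      · exact h
      · exfalso
        have := h0 i hi
        rw [← h] at hle
        linarith
    have hge : ∀ j ∈ I, 0 ≤ u σ j + ε * (1 + σ) := by
      intro j hj
      have hc := ((hd σ hσT j hj).continuousAt.add
        (by fun_prop : ContinuousAt (fun s => ε * (1 + s)) σ)).continuousWithinAt (s := Iio σ)
      refine ge_of_tendsto hc ?_
      filter_upwards [Ioo_mem_nhdsLT hσ0] with s hs
      exact (hpos s ⟨hs.1.le, hs.2.le.trans hσT.2⟩ hs.2 j hj).le
    have hzero : u σ i + ε * (1 + σ) = 0 := le_antisymm hle (hge i hi)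
    have hu' : 0 ≤ u' σ i := by
      refine hmin σ hσT i hi ?_ fun j hj => ?_
      · nlinarith
      · linarith [hge j hj]
    have hder : HasDerivAt (fun s => u s i + ε * (1 + s)) (u' σ i + ε) σ := by
      have := (hd σ hσT i hi).add (((hasDerivAt_id σ).const_add 1).const_mul ε)
      rw [mul_one] at this
      exact this
    have hslope := (hasDerivAt_iff_tendsto_slope_left_right.1 hder).1
    have : u' σ i + ε ≤ 0 := by
      refine le_of_tendsto hslope ?_
      filter_upwards [Ioo_mem_nhdsLT hσ0] with s hs
      have h1 := hpos s ⟨hs.1.le, hs.2.le.trans hσT.2⟩ hs.2 i hi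
      rw [slope_def_field, hzero, sub_zero]
      exact div_nonpos_of_nonneg_of_nonpos (by linarith) (by linarith [hs.2])
    linarith
  intro s hs i hi
  by_contra hneg
  push Not at hneg
  have h1 : 0 < 1 + s := by linarith [hs.1]
  -- This `ε` makes the perturbed value at `(s, i)` exactly zero.
  have := key (-u s i / (1 + s)) (div_pos (by linarith) h1) s hs i hi
  rw [div_mul_cancel₀ _ h1.ne'] at this
  linarith

attribute [local instance] Matrix.linftyOpNormedRing Matrix.linftyOpNormedAlgebra in
/-- The derivative of the matrix exponential, applied to a vector. -/
theorem hasDerivAt_exp_mulVec {ι : Type*} [Fintype ι] [DecidableEq ι] (A : Matrix ι ι ℝ)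
    (v : ι → ℝ) (s : ℝ) (i : ι) :
    HasDerivAt (fun r : ℝ => (NormedSpace.exp (r • A)).mulVec v i)
      ((NormedSpace.exp (s • A)).mulVec (A.mulVec v) i) s := by
  have h := hasDerivAt_exp_smul_const (𝕂 := ℝ) A s
  have hl : IsBoundedLinearMap ℝ fun M : Matrix ι ι ℝ => M.mulVec v i := by
    let l : Matrix ι ι ℝ →ₗ[ℝ] ℝ :=
      { toFun := fun M => M.mulVec v i
        map_add' := fun M M' => by simp [Matrix.add_mulVec]
        map_smul' := fun c M => by simp [Matrix.smul_mulVec] }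
    exact (LinearMap.toContinuousLinearMap l).isBoundedLinearMap
  have := (hl.toContinuousLinearMap.hasFDerivAt).comp_hasDerivAt s h
  rw [Matrix.mulVec_mulVec]
  exact this

attribute [local instance] Matrix.linftyOpNormedRing Matrix.linftyOpNormedAlgebra in
theorem exp_smul_mulVec_comm {ι : Type*} [Fintype ι] [DecidableEq ι] (A : Matrix ι ι ℝ)
    (v : ι → ℝ) (s : ℝ) :
    (NormedSpace.exp (s • A)).mulVec (A.mulVec v) = A.mulVec ((NormedSpace.exp (s • A)).mulVec v) := by
  have h : Commute (NormedSpace.exp (s • A)) A := ((Commute.refl A).smul_left s).exp_left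
  rw [Matrix.mulVec_mulVec, Matrix.mulVec_mulVec, h.eq]

/-- Linear systems of differential equations have global solutions. -/
theorem exists_linear_flow {ι : Type*} [Fintype ι] [DecidableEq ι]
    (B : (ι → ℝ) →ₗ[ℝ] (ι → ℝ)) (v : ι → ℝ) :
    ∃ u : ℝ → ι → ℝ, u 0 = v ∧ ∀ s i, HasDerivAt (fun r => u r i) (B (u s) i) s := by
  refine ⟨fun s => (NormedSpace.exp (s • LinearMap.toMatrix' B)).mulVec v, ?_, fun s i => ?_⟩
  · simp [NormedSpace.exp_zero]
  · have h := hasDerivAt_exp_mulVec (LinearMap.toMatrix' B) v s i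
    rw [exp_smul_mulVec_comm, LinearMap.toMatrix'_mulVec] at h
    exact h

end SEP

/-! ### The discrete heat equation with killing, its gradient, and the reflected kernel. -/

namespace SEP

open Set

/-- Difference with the left neighbour; at the site `1` it is a killing term of intensity `κ`. -/
def diffLeft (κ : ℝ) (f : ℕ → ℝ) (x : ℕ) : ℝ :=
  if x = 1 then -(κ * f x) else f (x - 1) - f x

/-- Difference with the right neighbour; at the site `N - 1` it is a killing term. -/
def diffRight (κ : ℝ) (N : ℕ) (f : ℕ → ℝ) (x : ℕ) : ℝ :=
  if x + 1 = N then -(κ * f x) else f (x + 1) - f x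

/-- The discrete Laplacian on `{1, …, N - 1}` with killing at the end points. -/
def lap (κL κR : ℝ) (N : ℕ) (f : ℕ → ℝ) (x : ℕ) : ℝ :=
  diffLeft κL f x + diffRight κR N f x

/-- The discrete gradient, completed at `0` and `N - 1` by the boundary fluxes. -/
def grad (κL κR : ℝ) (N : ℕ) (f : ℕ → ℝ) (x : ℕ) : ℝ :=
  if x = 0 then κL * f 1 else if x + 1 = N then -(κR * f x) else f (x + 1) - f x

/-- The boundary fluxes in `grad` are chosen so that `lap` is a divergence up to the end sites. The
gradient therefore solves an equation of its own, whose end terms are differences rather than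
killing terms. This is why its maximum principle holds for bounds of either sign. -/
theorem lap_eq_grad_sub {κL κR : ℝ} {N : ℕ} (f : ℕ → ℝ) {x : ℕ} (hx : 1 ≤ x) (hxN : x + 1 ≤ N) :
    lap κL κR N f x = grad κL κR N f x - grad κL κR N f (x - 1) := by
  unfold lap grad diffLeft diffRight
  rcases eq_or_ne x 1 with rfl | h1
  · simp; split_ifs <;> ring
  · have h2 : x - 1 ≠ 0 := by omega
    have h3 : x - 1 + 1 ≠ N := by omega
    have h4 : x ≠ 0 := by omega
    have h5 : x - 1 + 1 = x := by omega
    simp only [h1, h2, h4, if_false, h5, (show x ≠ N by omega)]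
    split_ifs <;> ring

/-- `f` solves the heat equation with diffusivity `c` on `{1, …, N - 1}`, with killing. -/
def IsHeat (c κL κR : ℝ) (N : ℕ) (f : ℝ → ℕ → ℝ) : Prop :=
  ∀ s, ∀ x ∈ Finset.Icc 1 (N - 1), HasDerivAt (fun r => f r x) (c * lap κL κR N (f s) x) s

/-- Extension by zero of a function on the sites. -/
noncomputable def extend {N : ℕ} (u : Site N → ℝ) (x : ℕ) : ℝ :=
  if h : x ∈ Finset.Icc 1 (N - 1) then u ⟨x, h⟩ else 0

theorem extend_of_mem {N : ℕ} (u : Site N → ℝ) {x : ℕ} (h : x ∈ Finset.Icc 1 (N - 1)) :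
    extend u x = u ⟨x, h⟩ := dif_pos h

@[simp] theorem extend_coe {N : ℕ} (u : Site N → ℝ) (x : Site N) : extend u x = u x :=
  extend_of_mem u x.2

theorem extend_add {N : ℕ} (u v : Site N → ℝ) : extend (u + v) = extend u + extend v := by
  ext x
  by_cases h : x ∈ Finset.Icc 1 (N - 1) <;> simp only [extend, h, Pi.add_apply, dite_true, dite_false, add_zero]

theorem extend_smul {N : ℕ} (c : ℝ) (u : Site N → ℝ) : extend (c • u) = c • extend u := by
  ext x
  by_cases h : x ∈ Finset.Icc 1 (N - 1) <;>
    simp only [extend, h, Pi.smul_apply, dite_true, dite_false, smul_zero]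

theorem lap_add (κL κR : ℝ) (N : ℕ) (f g : ℕ → ℝ) (x : ℕ) :
    lap κL κR N (f + g) x = lap κL κR N f x + lap κL κR N g x := by
  simp only [lap, diffLeft, diffRight, Pi.add_apply]
  split_ifs <;> ring

theorem lap_smul (κL κR : ℝ) (N : ℕ) (c : ℝ) (f : ℕ → ℝ) (x : ℕ) :
    lap κL κR N (c • f) x = c * lap κL κR N f x := by
  simp only [lap, diffLeft, diffRight, Pi.smul_apply, smul_eq_mul]
  split_ifs <;> ring

/-- The heat equation has a solution with given initial value. -/
theorem exists_isHeat (c κL κR : ℝ) (N : ℕ) (f₀ : ℕ → ℝ) :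
    ∃ f, IsHeat c κL κR N f ∧ ∀ x ∈ Finset.Icc 1 (N - 1), f 0 x = f₀ x := by
  let B : (Site N → ℝ) →ₗ[ℝ] (Site N → ℝ) :=
    { toFun := fun u x => c * lap κL κR N (extend u) x
      map_add' := fun u v => by
        ext x
        simp only [extend_add, lap_add, Pi.add_apply, mul_add]
      map_smul' := fun a u => by
        ext x
        simp only [extend_smul, lap_smul, Pi.smul_apply, smul_eq_mul, RingHom.id_apply]
        ring }
  obtain ⟨u, hu0, hu⟩ := exists_linear_flow B fun x => f₀ x
  refine ⟨fun s => extend (u s), fun s x hx => ?_, fun x hx => ?_⟩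
  · simp only [extend_of_mem _ hx]
    exact hu s ⟨x, hx⟩
  · simp only [extend_of_mem _ hx, hu0]

theorem IsHeat.neg {c κL κR : ℝ} {N : ℕ} {f : ℝ → ℕ → ℝ} (hf : IsHeat c κL κR N f) :
    IsHeat c κL κR N fun s => (-1 : ℝ) • f s := by
  intro s x hx
  rw [lap_smul]
  exact ((hf s x hx).const_mul (-1)).congr_deriv (by ring)

theorem IsHeat.sub {c κL κR : ℝ} {N : ℕ} {f g : ℝ → ℕ → ℝ} (hf : IsHeat c κL κR N f)
    (hg : IsHeat c κL κR N g) : IsHeat c κL κR N fun s => f s + (-1 : ℝ) • g s := by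
  intro s x hx
  rw [lap_add, mul_add]
  exact (hf s x hx).add (hg.neg s x hx)

/-- The maximum principle for the heat equation. -/
theorem IsHeat.le_of_initial_le {c κL κR : ℝ} {N : ℕ} {f : ℝ → ℕ → ℝ}
    (hf : IsHeat c κL κR N f) (hc : 0 ≤ c) (hL : 0 ≤ κL) (hR : 0 ≤ κR) {M : ℝ} (hM : 0 ≤ M)
    (h0 : ∀ x ∈ Finset.Icc 1 (N - 1), f 0 x ≤ M) {s : ℝ} (hs : 0 ≤ s) :
    ∀ x ∈ Finset.Icc 1 (N - 1), f s x ≤ M := by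
  have key := nonneg_of_deriv_nonneg_at_min (Finset.Icc 1 (N - 1)) (T := s)
    (fun r x => M - f r x) (fun r x => -(c * lap κL κR N (f r) x))
    (fun r _ x hx => (hf r x hx).const_sub M) (fun x hx => by linarith [h0 x hx]) ?_ s ⟨hs, le_rfl⟩
  · intro x hx
    linarith [key x hx]
  · intro r _ x hx hneg hmin
    rw [Left.nonneg_neg_iff]
    refine mul_nonpos_of_nonneg_of_nonpos hc ?_
    have hpos : 0 ≤ f r x := by linarith
    have hmax : ∀ z ∈ Finset.Icc 1 (N - 1), f r z ≤ f r x := fun z hz => by linarith [hmin z hz]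
    rw [Finset.mem_Icc] at hx
    refine add_nonpos ?_ ?_
    · unfold diffLeft
      split_ifs with h
      · have := mul_nonneg hL hpos; linarith
      · linarith [hmax (x - 1) (Finset.mem_Icc.2 (by omega))]
    · unfold diffRight
      split_ifs with h
      · have := mul_nonneg hR hpos; linarith
      · linarith [hmax (x + 1) (Finset.mem_Icc.2 (by omega))]

theorem IsHeat.abs_le_of_initial_abs_le {c κL κR : ℝ} {N : ℕ} {f : ℝ → ℕ → ℝ}
    (hf : IsHeat c κL κR N f) (hc : 0 ≤ c) (hL : 0 ≤ κL) (hR : 0 ≤ κR) {M : ℝ} (hM : 0 ≤ M)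
    (h0 : ∀ x ∈ Finset.Icc 1 (N - 1), |f 0 x| ≤ M) {s : ℝ} (hs : 0 ≤ s) :
    ∀ x ∈ Finset.Icc 1 (N - 1), |f s x| ≤ M := by
  intro x hx
  have h1 := hf.le_of_initial_le hc hL hR hM (fun z hz => (abs_le.1 (h0 z hz)).2) hs x hx
  have h2 := hf.neg.le_of_initial_le hc hL hR hM
    (fun z hz => by simpa using neg_le.1 (abs_le.1 (h0 z hz)).1) hs x hx
  simp only [Pi.smul_apply, smul_eq_mul] at h2
  exact abs_le.2 ⟨by linarith, h1⟩

theorem IsHeat.hasDerivAt_grad {c κL κR : ℝ} {N : ℕ} (hN : 2 ≤ N) {f : ℝ → ℕ → ℝ}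
    (hf : IsHeat c κL κR N f) (s : ℝ) {x : ℕ} (hx : x < N) :
    HasDerivAt (fun r => grad κL κR N (f r) x) (c * grad κL κR N (lap κL κR N (f s)) x) s := by
  unfold grad
  by_cases h0 : x = 0
  · simp only [h0, if_true]
    exact ((hf s 1 (Finset.mem_Icc.2 (by omega))).const_mul κL).congr_deriv (by ring)
  · by_cases h1 : x + 1 = N
    · simp only [h0, h1, if_true, if_false]
      exact ((hf s x (Finset.mem_Icc.2 (by omega))).const_mul κR).neg.congr_deriv (by ring)
    · simp only [h0, h1, if_false]
      exact ((hf s (x + 1) (Finset.mem_Icc.2 (by omega))).sub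
        (hf s x (Finset.mem_Icc.2 (by omega)))).congr_deriv (by ring)

/-- The gradient of a solution of the heat equation obeys a maximum principle as well. -/
theorem IsHeat.grad_le_of_initial_le {c κL κR : ℝ} {N : ℕ} (hN : 2 ≤ N) {f : ℝ → ℕ → ℝ}
    (hf : IsHeat c κL κR N f) (hc : 0 ≤ c) (hL : 0 ≤ κL) (hR : 0 ≤ κR) {M : ℝ}
    (h0 : ∀ x < N, grad κL κR N (f 0) x ≤ M) {s : ℝ} (hs : 0 ≤ s) :
    ∀ x < N, grad κL κR N (f s) x ≤ M := by
  have key := nonneg_of_deriv_nonneg_at_min (Finset.range N) (T := s)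
    (fun r x => M - grad κL κR N (f r) x)
    (fun r x => -(c * grad κL κR N (lap κL κR N (f r)) x))
    (fun r _ x hx => (hf.hasDerivAt_grad hN r (Finset.mem_range.1 hx)).const_sub M)
    (fun x hx => by linarith [h0 x (Finset.mem_range.1 hx)]) ?_ s ⟨hs, le_rfl⟩
  · intro x hx
    linarith [key x (Finset.mem_range.2 hx)]
  · intro r _ x hx _ hmin
    rw [Left.nonneg_neg_iff]
    refine mul_nonpos_of_nonneg_of_nonpos hc ?_
    rw [Finset.mem_range] at hx
    have hmax : ∀ z < N, grad κL κR N (f r) z ≤ grad κL κR N (f r) x := fun z hz => by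
      linarith [hmin z (Finset.mem_range.2 hz)]
    have hl : ∀ z, 1 ≤ z → z + 1 ≤ N → lap κL κR N (f r) z
        = grad κL κR N (f r) z - grad κL κR N (f r) (z - 1) := fun z h1 h2 =>
      lap_eq_grad_sub (f r) h1 h2
    rw [grad]
    split_ifs with h1 h2
    · rw [hl 1 le_rfl hN]
      subst h1
      exact mul_nonpos_of_nonneg_of_nonpos hL (by linarith [hmax 1 (by omega)])
    · rw [hl x (by omega) (by omega), Left.neg_nonpos_iff]
      exact mul_nonneg hR (by linarith [hmax (x - 1) (by omega)])
    · rw [hl x (by omega) (by omega), hl (x + 1) (by omega) (by omega), Nat.add_sub_cancel]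
      linarith [hmax (x - 1) (by omega), hmax (x + 1) (by omega)]

theorem grad_smul (κL κR : ℝ) (N : ℕ) (c : ℝ) (f : ℕ → ℝ) (x : ℕ) :
    grad κL κR N (c • f) x = c * grad κL κR N f x := by
  simp only [grad, Pi.smul_apply, smul_eq_mul]
  split_ifs <;> ring

theorem IsHeat.abs_grad_le_of_initial_abs_le {c κL κR : ℝ} {N : ℕ} (hN : 2 ≤ N)
    {f : ℝ → ℕ → ℝ} (hf : IsHeat c κL κR N f) (hc : 0 ≤ c) (hL : 0 ≤ κL) (hR : 0 ≤ κR) {M : ℝ}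
    (h0 : ∀ x < N, |grad κL κR N (f 0) x| ≤ M) {s : ℝ} (hs : 0 ≤ s) :
    ∀ x < N, |grad κL κR N (f s) x| ≤ M := by
  intro x hx
  have h1 := hf.grad_le_of_initial_le hN hc hL hR (fun z hz => (abs_le.1 (h0 z hz)).2) hs x hx
  have h2 := hf.neg.grad_le_of_initial_le hN hc hL hR (M := M)
    (fun z hz => by rw [grad_smul]; linarith [(abs_le.1 (h0 z hz)).1]) hs x hx
  rw [grad_smul] at h2
  exact abs_le.2 ⟨by linarith, h1⟩

/-- The reflected heat kernel from the site `1`, at times of order `1`, is bounded by `1 / m` up to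
an exponentially small term, for every `m` below the diffusive scale. -/
theorem exists_reflected_kernel {c : ℝ} (hc : 0 ≤ c) {N : ℕ} (hN : 2 ≤ N) :
    ∃ f : ℝ → ℕ → ℝ, IsHeat c 0 0 N f ∧ f 0 1 = 1 ∧
      (∀ s, 0 ≤ s → ∀ x ∈ Finset.Icc 1 (N - 1), 0 ≤ f s x) ∧
      ∀ s, 0 ≤ s → ∀ m : ℕ, 1 ≤ m → m < N → ∀ x ∈ Finset.Icc 1 (N - 1),
        f s x ≤ 1 / m + 2 * Real.exp (-(c / (m : ℝ) ^ 2 * s)) := by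
  obtain ⟨f, hf, hf0⟩ := exists_isHeat c 0 0 N fun x => if x = 1 then 1 else 0
  have hnn : ∀ s, 0 ≤ s → ∀ x ∈ Finset.Icc 1 (N - 1), 0 ≤ f s x := by
    intro s hs x hx
    have := hf.neg.le_of_initial_le hc le_rfl le_rfl le_rfl
      (fun z hz => by simp only [Pi.smul_apply, smul_eq_mul, hf0 z hz]; split_ifs <;> norm_num) hs x hx
    simp only [Pi.smul_apply, smul_eq_mul] at this
    linarith
  -- The initial indicator of the site `1` is nonincreasing, and the maximum principle for gradients
  -- with bound `0` preserves this.
  have hgrad : ∀ s, 0 ≤ s → ∀ x < N, grad 0 0 N (f s) x ≤ 0 := by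
    intro s hs
    refine hf.grad_le_of_initial_le hN hc le_rfl le_rfl (fun x hx => ?_) hs
    unfold grad
    split_ifs with h1 h2
    · simp
    · simp
    · rw [hf0 _ (Finset.mem_Icc.2 (by omega)), hf0 _ (Finset.mem_Icc.2 (by omega)), if_neg (by omega)]
      split_ifs <;> norm_num
  have hanti : ∀ s, 0 ≤ s → ∀ k x, 1 ≤ x → x + k + 1 ≤ N → f s (x + k) ≤ f s x := by
    intro s hs k
    induction k with
    | zero => intro x _ _; simp
    | succ k ih =>
      intro x hx hk
      have h := hgrad s hs (x + k) (by omega)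
      rw [grad, if_neg (by omega), if_neg (by omega)] at h
      have := ih x hx (by omega)
      rw [← add_assoc]
      linarith
  -- Without killing the Laplacian telescopes to a vanishing flux, so mass is conserved.
  have hmass : ∀ s, ∑ x ∈ Finset.Icc 1 (N - 1), f s x = 1 := by
    have hder : ∀ s, HasDerivAt (fun r => ∑ x ∈ Finset.Icc 1 (N - 1), f r x) 0 s := by
      intro s
      have h := HasDerivAt.fun_sum (u := Finset.Icc 1 (N - 1)) fun x hx => hf s x hx
      refine h.congr_deriv ?_
      rw [← Finset.mul_sum]
      have : ∀ n, n + 1 ≤ N → ∑ x ∈ Finset.Icc 1 n, lap 0 0 N (f s) x = grad 0 0 N (f s) n := by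
        intro n
        induction n with
        | zero => simp [grad]
        | succ n ih =>
          intro hn
          rw [Finset.sum_Icc_succ_top (by omega), ih (by omega),
            lap_eq_grad_sub _ (by omega) (by omega), Nat.add_sub_cancel]
          ring
      rw [this (N - 1) (by omega), grad, if_neg (by omega), if_pos (by omega)]
      simp
    intro s
    have hconst := is_const_of_deriv_eq_zero (f := fun r => ∑ x ∈ Finset.Icc 1 (N - 1), f r x)
      (fun r => (hder r).differentiableAt) (fun r => (hder r).deriv) s 0
    refine hconst.trans ?_
    rw [ Finset.sum_congr rfl hf0, Finset.sum_ite_eq' , if_pos (Finset.mem_Icc.2 (by omega))]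
  -- Monotonicity and unit mass: the `x` values on `1, …, x` are each at least `f s x`.
  have hfar : ∀ s, 0 ≤ s → ∀ x ∈ Finset.Icc 1 (N - 1), (x : ℝ) * f s x ≤ 1 := by
    intro s hs x hx
    rw [Finset.mem_Icc] at hx
    rw [← hmass s]
    calc (x : ℝ) * f s x = ∑ _z ∈ Finset.Icc 1 x, f s x := by simp
      _ ≤ ∑ z ∈ Finset.Icc 1 x, f s z := by
          refine Finset.sum_le_sum fun z hz => ?_
          rw [Finset.mem_Icc] at hz
          have := hanti s hs (x - z) z hz.1 (by omega)
          rwa [Nat.add_sub_cancel' hz.2] at this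
      _ ≤ _ := Finset.sum_le_sum_of_subset_of_nonneg (Finset.Icc_subset_Icc le_rfl hx.2)
          fun z hz _ => hnn s hs z hz
  refine ⟨f, hf, by rw [hf0 1 (Finset.mem_Icc.2 (by omega)), if_pos rfl], hnn, ?_⟩
  intro s hs m hm hmN
  have hm0 : (0 : ℝ) < m := by exact_mod_cast hm
  set l := c / (m : ℝ) ^ 2 with hl
  have hl0 : 0 ≤ l := by positivity
  -- Supersolution on `{1, …, m}`: `2 - x²/m²` lies in `[1, 2]` there and its Laplacian is at most
  -- `-2/m²`, so decay at rate `c/m²` is admissible. It exceeds `1` at time zero, and at `x = m` it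
  -- exceeds the bound `1/m` given by `hfar`.
  let V : ℝ → ℕ → ℝ := fun r x => 1 / m + Real.exp (-(l * r)) * (2 - (x : ℝ) ^ 2 / (m : ℝ) ^ 2)
  have hVd : ∀ r x, HasDerivAt (fun r => V r x)
      (-(l * Real.exp (-(l * r)) * (2 - (x : ℝ) ^ 2 / (m : ℝ) ^ 2))) r := by
    intro r x
    have h := (((hasDerivAt_id r).const_mul l).neg.exp.mul_const
      (2 - (x : ℝ) ^ 2 / (m : ℝ) ^ 2)).const_add (1 / (m : ℝ))
    refine h.congr_deriv ?_
    simp only [id, mul_one, Pi.neg_apply]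
    ring
  have hfm : ∀ r, 0 ≤ r → ∀ x ∈ Finset.Icc 1 (N - 1), m ≤ x → f r x ≤ 1 / m := by
    intro r hr x hx hmx
    rw [le_div_iff₀ hm0]
    have h1 := hfar r hr x hx
    have h2 := hnn r hr x hx
    have : (m : ℝ) ≤ x := by exact_mod_cast hmx
    nlinarith
  have hq : ∀ x : ℕ, x ≤ m → (x : ℝ) ^ 2 / (m : ℝ) ^ 2 ≤ 1 := by
    intro x hx
    rw [div_le_one (by positivity)]
    have : (x : ℝ) ≤ m := by exact_mod_cast hx
    gcongr
  have key := nonneg_of_deriv_nonneg_at_min ((Finset.Icc 1 (N - 1)).filter (· ≤ m)) (T := s)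
    (fun r x => V r x - f r x) (fun r x =>
      -(l * Real.exp (-(l * r)) * (2 - (x : ℝ) ^ 2 / (m : ℝ) ^ 2)) - c * lap 0 0 N (f r) x)
    (fun r _ x hx => (hVd r x).sub (hf r x (Finset.mem_filter.1 hx).1)) ?_ ?_ s ⟨hs, le_rfl⟩
  · intro x hx
    by_cases hxm : x ≤ m
    · have := key x (Finset.mem_filter.2 ⟨hx, hxm⟩)
      have h3 : 0 ≤ (x : ℝ) ^ 2 / (m : ℝ) ^ 2 := by positivity
      have h4 := Real.exp_pos (-(l * s))
      simp only [V] at this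
      nlinarith
    · have := hfm s hs x hx (by omega)
      have h4 := Real.exp_pos (-(l * s))
      linarith
  · intro x hx
    rw [Finset.mem_filter] at hx
    have h1 := hq x hx.2
    have h2 : (0 : ℝ) < 1 / m := by positivity
    simp only [V, hf0 x hx.1, mul_zero, neg_zero, Real.exp_zero]
    split_ifs <;> linarith
  · intro r hr x hx hneg hmin
    rw [Finset.mem_filter] at hx
    have hE := Real.exp_pos (-(l * r))
    -- A negative minimum of `V - f` cannot sit at `m`, so the right neighbour is still in the
    -- comparison region.
    have hxm : x < m := by
      by_contra hcon
      have h1 := hfm r hr.1 x hx.1 (by omega)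
      have h2 := hq x hx.2
      simp only [V] at hneg
      nlinarith
    have hxx := Finset.mem_Icc.1 hx.1
    have hlap : lap 0 0 N (f r) x ≤ -(2 * Real.exp (-(l * r)) / (m : ℝ) ^ 2) := by
      have hm2 : (0 : ℝ) < (m : ℝ) ^ 2 := by positivity
      have step : ∀ z ∈ Finset.Icc 1 (N - 1), z ≤ m → f r z - f r x
          ≤ Real.exp (-(l * r)) * ((x : ℝ) ^ 2 - (z : ℝ) ^ 2) / (m : ℝ) ^ 2 := by
        intro z hz hzm
        have := hmin z (Finset.mem_filter.2 ⟨hz, hzm⟩)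
        simp only [V] at this
        have e : Real.exp (-(l * r)) * ((x : ℝ) ^ 2 - (z : ℝ) ^ 2) / (m : ℝ) ^ 2
          = Real.exp (-(l * r)) * (2 - (z : ℝ) ^ 2 / (m : ℝ) ^ 2)
            - Real.exp (-(l * r)) * (2 - (x : ℝ) ^ 2 / (m : ℝ) ^ 2) := by ring
        linarith
      have hright := step (x + 1) (Finset.mem_Icc.2 (by omega)) (by omega)
      rw [lap, diffLeft, diffRight, if_neg (show x + 1 ≠ N by omega)]
      push_cast at hright
      split_ifs with h
      · have e : Real.exp (-(l * r)) * ((x : ℝ) ^ 2 - ((x : ℝ) + 1) ^ 2) / (m : ℝ) ^ 2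
            = -(2 * Real.exp (-(l * r)) / (m : ℝ) ^ 2) - Real.exp (-(l * r)) / (m : ℝ) ^ 2 := by
          rw [h]; push_cast; ring
        have : 0 < Real.exp (-(l * r)) / (m : ℝ) ^ 2 := by positivity
        linarith
      · have hleft := step (x - 1) (Finset.mem_Icc.2 (by omega)) (by omega)
        rw [Nat.cast_sub hxx.1, Nat.cast_one] at hleft
        have e : Real.exp (-(l * r)) * ((x : ℝ) ^ 2 - ((x : ℝ) + 1) ^ 2) / (m : ℝ) ^ 2
            + Real.exp (-(l * r)) * ((x : ℝ) ^ 2 - ((x : ℝ) - 1) ^ 2) / (m : ℝ) ^ 2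
            = -(2 * Real.exp (-(l * r)) / (m : ℝ) ^ 2) := by ring
        linarith
    have h1 := hq x hx.2
    have h2 : 0 ≤ (x : ℝ) ^ 2 / (m : ℝ) ^ 2 := by positivity
    have h3 : l * (m : ℝ) ^ 2 = c := by rw [hl]; field_simp
    have h4 : c * lap 0 0 N (f r) x ≤ c * -(2 * Real.exp (-(l * r)) / (m : ℝ) ^ 2) :=
      mul_le_mul_of_nonneg_left hlap hc
    have h5 : c * -(2 * Real.exp (-(l * r)) / (m : ℝ) ^ 2) = -(2 * (l * Real.exp (-(l * r)))) := by
      rw [← h3]; field_simp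
    have h6 : 0 ≤ l * Real.exp (-(l * r)) := by positivity
    nlinarith

end SEP

/-! ### The generator of the two-particle dual and its supersolutions. -/

namespace SEP

open Set

/-- The generator of the two-particle dual of SEP(`α`), acting on functions of `x ≤ y`. The two
particles perform random walks of rate `α`, killed at the boundary with intensities `κL, κR`; they
interact when they are at distance at most one. -/
def pairGen (α : ℕ) (κL κR : ℝ) (N : ℕ) (F : ℕ → ℕ → ℝ) (x y : ℕ) : ℝ :=
  if x = y then
    2 * α * (diffLeft κL (fun z => F z y) x + diffRight κR N (F x) y)
  else if y = x + 1 then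
    α * (diffLeft κL (fun z => F z y) x + diffRight κR N (F x) y)
      + (α - 1) * (F x x + F y y - 2 * F x y)
  else
    α * (diffLeft κL (fun z => F z y) x + (F (x + 1) y - F x y)
      + ((F x (y - 1) - F x y) + diffRight κR N (F x) y))

/-- The state space of the two-particle dual: pairs `x < y`, and the diagonal if `α ≠ 1`. -/
def pairs (α N : ℕ) : Finset (ℕ × ℕ) :=
  (Finset.Icc 1 (N - 1) ×ˢ Finset.Icc 1 (N - 1)).filter
    fun z => z.1 < z.2 ∨ (z.1 = z.2 ∧ α ≠ 1)

theorem mem_pairs {α N x y : ℕ} :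
    (x, y) ∈ pairs α N ↔ 1 ≤ x ∧ x ≤ y ∧ y ≤ N - 1 ∧ (x = y → α ≠ 1) := by
  simp only [pairs, Finset.mem_filter, Finset.mem_product, Finset.mem_Icc]
  constructor
  · rintro ⟨⟨⟨h1, h2⟩, h3, h4⟩, h5⟩
    rcases h5 with h5 | h5
    · exact ⟨h1, h5.le, h4, fun h => by omega⟩
    · exact ⟨h1, h5.1.le, h4, fun _ => h5.2⟩
  · rintro ⟨h1, h2, h3, h4⟩
    refine ⟨⟨⟨h1, by omega⟩, by omega, h3⟩, ?_⟩
    rcases h2.lt_or_eq with h | h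
    · exact Or.inl h
    · exact Or.inr ⟨h, h4 h⟩

theorem pairGen_add (α : ℕ) (κL κR : ℝ) (N : ℕ) (F F' : ℕ → ℕ → ℝ) (x y : ℕ) :
    pairGen α κL κR N (fun x y => F x y + F' x y) x y
      = pairGen α κL κR N F x y + pairGen α κL κR N F' x y := by
  simp only [pairGen, diffLeft, diffRight]
  split_ifs <;> ring

theorem pairGen_const_mul (α : ℕ) (κL κR : ℝ) (N : ℕ) (c : ℝ) (F : ℕ → ℕ → ℝ) (x y : ℕ) :
    pairGen α κL κR N (fun x y => c * F x y) x y = c * pairGen α κL κR N F x y := by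
  simp only [pairGen, diffLeft, diffRight]
  split_ifs <;> ring

/-- Every term is either a nonnegative rate times a difference to another pair, or killing, which
has the right sign at a negative value. For `α = 1` the diagonal is outside the state space, but the
coefficient `α - 1` in front of it vanishes. -/
theorem pairGen_nonneg_of_min {α N : ℕ} (hα : 1 ≤ α) {κL κR : ℝ} (hL : 0 ≤ κL) (hR : 0 ≤ κR)
    {u : ℕ → ℕ → ℝ} {x y : ℕ} (hxy : (x, y) ∈ pairs α N) (hneg : u x y < 0)
    (hmin : ∀ z ∈ pairs α N, u x y ≤ u z.1 z.2) : 0 ≤ pairGen α κL κR N u x y := by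
  obtain ⟨h1, h2, h3, h4⟩ := mem_pairs.1 hxy
  have hm : ∀ x' y', 1 ≤ x' → x' ≤ y' → y' ≤ N - 1 → (x' = y' → α ≠ 1) → u x y ≤ u x' y' :=
    fun x' y' a b c d => hmin (x', y') (mem_pairs.2 ⟨a, b, c, d⟩)
  have ha : (1 : ℝ) ≤ α := by exact_mod_cast hα
  have hl : 0 ≤ diffLeft κL (fun z => u z y) x := by
    unfold diffLeft
    split_ifs with h
    · have := mul_nonpos_of_nonneg_of_nonpos hL hneg.le; linarith
    · linarith [hm (x - 1) y (by omega) (by omega) h3 (by omega)]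
  have hr : 0 ≤ diffRight κR N (u x) y := by
    unfold diffRight
    split_ifs with h
    · have := mul_nonpos_of_nonneg_of_nonpos hR hneg.le; linarith
    · linarith [hm x (y + 1) (by omega) (by omega) (by omega) (by omega)]
  unfold pairGen
  split_ifs with e1 e2
  · positivity
  · refine add_nonneg (by positivity) ?_
    rcases eq_or_ne α 1 with rfl | h
    · simp
    · refine mul_nonneg (by linarith) ?_
      linarith [hm x x h1 le_rfl (by omega) (fun _ => h),
        hm y y (by omega) le_rfl (by omega) (fun _ => h)]
  · have a := hm (x + 1) y (by omega) (by omega) h3 (by omega)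
    have b := hm x (y - 1) h1 (by omega) (by omega) (by omega)
    have : 0 ≤ diffLeft κL (fun z => u z y) x + (u (x + 1) y - u x y)
      + ((u x (y - 1) - u x y) + diffRight κR N (u x) y) := by linarith
    positivity

theorem pairGen_one_nonpos (α : ℕ) {κL κR : ℝ} (hL : 0 ≤ κL) (hR : 0 ≤ κR) (N x y : ℕ) :
    pairGen α κL κR N (fun _ _ => 1) x y ≤ 0 := by
  have hl : diffLeft κL (fun _ => 1) x ≤ 0 := by
    unfold diffLeft; split_ifs <;> linarith
  have hr : diffRight κR N (fun _ => 1) y ≤ 0 := by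
    unfold diffRight; split_ifs <;> linarith
  have ha : (0 : ℝ) ≤ α := Nat.cast_nonneg α
  unfold pairGen
  split_ifs <;> nlinarith

/-- An upper bound for the resolvent of the survival probability near the left boundary. -/
theorem pairGen_survival_le {α N : ℕ} (hα : 1 ≤ α) {κL κR q r : ℝ} (hR : 0 ≤ κR)
    (hr0 : 0 ≤ r) (hr1 : r ≤ 1) (hq0 : 0 ≤ q) (hq1 : q ≤ 1)
    (hq : q * (1 - r) ≤ κL * (1 - q * r)) {x y : ℕ} (hx : 1 ≤ x) (hxy : x ≤ y) :
    pairGen α κL κR N (fun z _ => 1 - q * r ^ z) x y ≤ -(α * (q * r ^ (x - 1) * (1 - r) ^ 2)) := by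
  have ha : (1 : ℝ) ≤ α := by exact_mod_cast hα
  obtain ⟨k, rfl⟩ : ∃ k, x = k + 1 := ⟨x - 1, by omega⟩
  have hrk : 0 ≤ r ^ k := by positivity
  have hrk1 : r ^ (k + 1) ≤ 1 := pow_le_one₀ hr0 hr1
  have hw : 0 ≤ 1 - q * r ^ (k + 1) := by nlinarith [pow_nonneg hr0 (k + 1)]
  have hl : diffLeft κL (fun z => 1 - q * r ^ z) (k + 1) ≤ -(q * r ^ k * (1 - r)) := by
    simp only [diffLeft]
    split_ifs with h
    · have : k = 0 := by omega
      subst this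
      simpa using hq
    · rw [Nat.add_sub_cancel, pow_succ]
      exact le_of_eq (by ring)
  have hrt : diffRight κR N (fun _ => 1 - q * r ^ (k + 1)) y ≤ 0 := by
    unfold diffRight
    split_ifs
    · have := mul_nonneg hR hw; linarith
    · simp
  set P := q * r ^ k with hP
  have hP0 : 0 ≤ P := by positivity
  have e1 : q * r ^ (k + 1) = P * r := by rw [hP, pow_succ]; ring
  have e2 : q * r ^ (k + 1 + 1) = P * r * r := by rw [hP, pow_succ, pow_succ]; ring
  have h01 : 0 ≤ P * (1 - r) := mul_nonneg hP0 (by linarith)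
  have h02 : 0 ≤ P * (1 - r) * r := mul_nonneg h01 hr0
  have ha0 : (0 : ℝ) ≤ α := by linarith
  rw [Nat.add_sub_cancel, ← hP]
  simp only [pairGen]
  rw [e1] at hrt
  rw [e1, e2]
  generalize diffLeft κL (fun z => 1 - q * r ^ z) (k + 1) = D at hl
  generalize diffRight κR N (fun _ => 1 - P * r) y = E at hrt
  split_ifs with c1 c2
  · have : 2 * (D + E) ≤ -(P * (1 - r) ^ 2) := by nlinarith
    have := mul_le_mul_of_nonneg_left this ha0
    linarith
  · subst c2
    have s1 : α * (D + E) ≤ α * (-(P * (1 - r))) :=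
      mul_le_mul_of_nonneg_left (by linarith) ha0
    -- For neighbours the inward jump of the left particle has rate `α - 1` instead of `α`. Inward
    -- jumps increase the profile, so the reduced rate only helps.
    have s2 : ((α : ℝ) - 1) * (1 - P * r + (1 - P * r * r) - 2 * (1 - P * r))
        ≤ α * (P * (1 - r) * r) := by nlinarith
    rw [e2]
    nlinarith
  · have : D + (1 - P * r * r - (1 - P * r)) + (1 - P * r - (1 - P * r) + E)
      ≤ -(P * (1 - r) ^ 2) := by nlinarith
    have := mul_le_mul_of_nonneg_left this ha0
    linarith

/-- An upper bound for the Green function of the set of neighbouring pairs. -/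
theorem pairGen_green_le {α N : ℕ} (hα : 1 ≤ α) {κL κR c c' : ℝ}
    (hc : 0 ≤ c) (hc' : 0 ≤ c') (hcL : 1 ≤ κL * (1 + c)) (hcR : 1 ≤ κR * (1 + c'))
    {x y : ℕ} (hx : 1 ≤ x) (hxy : x ≤ y) (hy : y ≤ N - 1) :
    pairGen α κL κR N (fun x y => ((x : ℝ) + c) * ((N : ℝ) - y + c')) x y
      ≤ if y = x + 1 then -((N : ℝ) - 1) else 0 := by
  have ha : (1 : ℝ) ≤ α := by exact_mod_cast hα
  have ha0 : (0 : ℝ) ≤ α := by linarith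
  have hx' : (1 : ℝ) ≤ x := by exact_mod_cast hx
  have hyN : (y : ℝ) + 1 ≤ N := by exact_mod_cast (show y + 1 ≤ N by omega)
  have hh : 0 ≤ (x : ℝ) + c := by linarith
  have hk : 0 ≤ (N : ℝ) - y + c' := by linarith
  have hl : diffLeft κL (fun z : ℕ => ((z : ℝ) + c) * ((N : ℝ) - y + c')) x
      ≤ -((N : ℝ) - y + c') := by
    unfold diffLeft
    split_ifs with h
    · subst h
      push_cast
      nlinarith
    · simp only [Nat.cast_sub hx]
      push_cast
      exact le_of_eq (by ring)
  have hr : diffRight κR N (fun z : ℕ => ((x : ℝ) + c) * ((N : ℝ) - z + c')) y ≤ -((x : ℝ) + c) := by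
    unfold diffRight
    split_ifs with h
    · have : (N : ℝ) = y + 1 := by exact_mod_cast h.symm
      rw [this]
      nlinarith
    · push_cast
      exact le_of_eq (by ring)
  unfold pairGen
  split_ifs with c1 c2 c3
  · omega
  · have : 0 ≤ (α : ℝ) * (((x : ℝ) + c) + ((N : ℝ) - y + c')) := by positivity
    nlinarith
  -- With `a = x + c` and `b = N - y + c'`, the outward jumps give at most `-α (a + b)` and the
  -- jumps onto the diagonal `(α - 1) (a + b)`. The total is at most `-(a + b) ≤ -(N - 1)`, whatever
  -- `α` is.
  · subst c3
    push_cast at *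
    have s1 := mul_le_mul_of_nonneg_left (add_le_add hl hr) ha0
    nlinarith
  · have : diffLeft κL (fun z : ℕ => ((z : ℝ) + c) * ((N : ℝ) - y + c')) x
        + (((x + 1 : ℕ) + c) * ((N : ℝ) - y + c') - ((x : ℝ) + c) * ((N : ℝ) - y + c'))
        + ((((x : ℝ) + c) * ((N : ℝ) - (y - 1 : ℕ) + c') - ((x : ℝ) + c) * ((N : ℝ) - y + c'))
          + diffRight κR N (fun z : ℕ => ((x : ℝ) + c) * ((N : ℝ) - z + c')) y) ≤ 0 := by
      rw [Nat.cast_sub (by omega : 1 ≤ y)]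
      push_cast
      nlinarith
    exact mul_nonpos_of_nonneg_of_nonpos ha0 this

theorem diffLeft_mul_const (κ : ℝ) (f : ℕ → ℝ) (b : ℝ) (x : ℕ) :
    diffLeft κ (fun z => f z * b) x = diffLeft κ f x * b := by
  unfold diffLeft; split_ifs <;> ring

theorem diffRight_const_mul (κ : ℝ) (N : ℕ) (f : ℕ → ℝ) (b : ℝ) (x : ℕ) :
    diffRight κ N (fun z => b * f z) x = b * diffRight κ N f x := by
  unfold diffRight; split_ifs <;> ring

/-- Negative dependence: on products, the two-particle dual is dominated by two independent
reflected walks. -/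
theorem pairGen_tensor_le {α N : ℕ} {κL κR : ℝ} (hL : 0 ≤ κL) (hR : 0 ≤ κR)
    {f : ℕ → ℝ} (hf : ∀ x ∈ Finset.Icc 1 (N - 1), 0 ≤ f x) {x y : ℕ} (hx : 1 ≤ x) (hxy : x ≤ y)
    (hy : y ≤ N - 1) :
    pairGen α κL κR N (fun x y => f x * f y) x y
      ≤ α * (lap 0 0 N f x * f y + f x * lap 0 0 N f y) := by
  have ha0 : (0 : ℝ) ≤ α := Nat.cast_nonneg α
  have hfx := hf x (Finset.mem_Icc.2 (by omega))
  have hfy := hf y (Finset.mem_Icc.2 (by omega))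
  have hl : diffLeft κL f x * f y ≤ diffLeft 0 f x * f y := by
    refine mul_le_mul_of_nonneg_right ?_ hfy
    unfold diffLeft
    split_ifs
    · have := mul_nonneg hL hfx; linarith
    · exact le_rfl
  have hr : f x * diffRight κR N f y ≤ f x * diffRight 0 N f y := by
    refine mul_le_mul_of_nonneg_left ?_ hfx
    unfold diffRight
    split_ifs
    · have := mul_nonneg hR hfy; linarith
    · exact le_rfl
  simp only [pairGen, diffLeft_mul_const, diffRight_const_mul, lap]
  split_ifs with c1 c2
  · subst c1
    have := mul_le_mul_of_nonneg_left (add_le_add hl hr) ha0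
    linarith
  -- Independent walks can exchange places or meet at the full rate `α`; the discrepancy is exactly
  -- `(f x - f (x + 1))²`, of the favourable sign.
  · subst c2
    have e1 : diffRight 0 N f x = f (x + 1) - f x := by rw [diffRight, if_neg (by omega)]
    have e2 : diffLeft 0 f (x + 1) = f x - f (x + 1) := by
      rw [diffLeft, if_neg (by omega), Nat.add_sub_cancel]
    have := mul_le_mul_of_nonneg_left (add_le_add hl hr) ha0
    rw [e1, e2]
    nlinarith [sq_nonneg (f x - f (x + 1))]
  · have e1 : diffRight 0 N f x = f (x + 1) - f x := by rw [diffRight, if_neg (by omega)]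
    have e2 : diffLeft 0 f y = f (y - 1) - f y := by rw [diffLeft, if_neg (by omega)]
    have := mul_le_mul_of_nonneg_left (add_le_add hl hr) ha0
    rw [e1, e2]
    linarith

theorem lap_reflect {κL κR : ℝ} {N : ℕ} (f : ℕ → ℝ) {x : ℕ} (hx : 1 ≤ x) (hxN : x ≤ N - 1) :
    lap κL κR N (fun z => f (N - z)) x = lap κR κL N f (N - x) := by
  simp only [lap, diffLeft, diffRight]
  rw [add_comm]
  congr 1
  · by_cases h : x + 1 = N
    · rw [if_pos h, if_pos (by omega)]
    · rw [if_neg h, if_neg (by omega), Nat.sub_sub]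
  · by_cases h : x = 1
    · rw [if_pos h, if_pos (by omega)]
    · rw [if_neg h, if_neg (by omega), show N - (x - 1) = N - x + 1 by omega]

theorem IsHeat.reflect {c κL κR : ℝ} {N : ℕ} {f : ℝ → ℕ → ℝ} (hf : IsHeat c κL κR N f) :
    IsHeat c κR κL N fun s x => f s (N - x) := by
  intro s x hx
  rw [Finset.mem_Icc] at hx
  rw [lap_reflect (f s) hx.1 hx.2]
  exact hf s (N - x) (Finset.mem_Icc.2 (by omega))

/-- Reflection also exchanges the two coordinates, which keeps pairs ordered; it transfers estimates
from the left boundary to the right one. -/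
theorem pairGen_reflect {α : ℕ} {κL κR : ℝ} {N : ℕ} (F : ℕ → ℕ → ℝ) {x y : ℕ} (hx : 1 ≤ x)
    (hxy : x ≤ y) (hy : y ≤ N - 1) :
    pairGen α κL κR N (fun x y => F (N - y) (N - x)) x y
      = pairGen α κR κL N F (N - y) (N - x) := by
  have hl : diffLeft κL (fun z => F (N - y) (N - z)) x = diffRight κL N (F (N - y)) (N - x) := by
    simp only [diffLeft, diffRight]
    by_cases h : x = 1
    · rw [if_pos h, if_pos (by omega)]
    · rw [if_neg h, if_neg (by omega), show N - (x - 1) = N - x + 1 by omega]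
  have hr : diffRight κR N (fun z => F (N - z) (N - x)) y
      = diffLeft κR (fun z => F z (N - x)) (N - y) := by
    simp only [diffLeft, diffRight]
    by_cases h : y + 1 = N
    · rw [if_pos h, if_pos (by omega)]
    · rw [if_neg h, if_neg (by omega), Nat.sub_sub]
  simp only [pairGen, hl, hr]
  by_cases h1 : x = y
  · rw [if_pos h1, if_pos (by omega), add_comm]
  · rw [if_neg h1, if_neg (show ¬N - y = N - x by omega)]
    by_cases h2 : y = x + 1
    · rw [if_pos h2, if_pos (by omega)]
      ring
    · rw [if_neg h2, if_neg (show ¬N - x = N - y + 1 by omega), show N - (y - 1) = N - y + 1 by omega,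
        show N - (x + 1) = N - x - 1 by omega]
      ring

end SEP

/-! ### Comparison for the pair equation. -/

namespace SEP

open Set

/-- `φ` solves on `[0, t]` the evolution equation of the two-particle dual, speeded up by `N²`,
with the source `src`. -/
def IsPairFlow (α : ℕ) (κL κR : ℝ) (N : ℕ) (t : ℝ) (φ src : ℝ → ℕ → ℕ → ℝ) : Prop :=
  ∀ s ∈ Icc 0 t, ∀ x y, (x, y) ∈ pairs α N → HasDerivAt (fun r => φ r x y)
    ((N : ℝ) ^ 2 * (pairGen α κL κR N (φ s) x y + src s x y)) s

theorem IsPairFlow.neg {α : ℕ} {κL κR : ℝ} {N : ℕ} {t : ℝ} {φ src : ℝ → ℕ → ℕ → ℝ}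
    (h : IsPairFlow α κL κR N t φ src) :
    IsPairFlow α κL κR N t (fun s x y => -1 * φ s x y) (fun s x y => -1 * src s x y) := by
  intro s hs x y hxy
  rw [pairGen_const_mul]
  exact ((h s hs x y hxy).const_mul (-1)).congr_deriv (by ring)

theorem reflect_mem_pairs {α N x y : ℕ} (h : (x, y) ∈ pairs α N) : (N - y, N - x) ∈ pairs α N := by
  rw [mem_pairs] at h ⊢
  exact ⟨by omega, by omega, by omega, fun e => h.2.2.2 (by omega)⟩

theorem IsPairFlow.reflect {α : ℕ} {κL κR : ℝ} {N : ℕ} {t : ℝ} {φ src : ℝ → ℕ → ℕ → ℝ}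
    (h : IsPairFlow α κL κR N t φ src) :
    IsPairFlow α κR κL N t (fun s x y => φ s (N - y) (N - x))
      (fun s x y => src s (N - y) (N - x)) := by
  intro s hs x y hxy
  have hm := mem_pairs.1 hxy
  rw [pairGen_reflect _ hm.1 hm.2.1 hm.2.2.1]
  exact h s hs _ _ (reflect_mem_pairs hxy)

/-- Comparison of a solution of the pair equation with a supersolution. -/
theorem IsPairFlow.le_of_supersolution {α : ℕ} (hα : 1 ≤ α) {κL κR : ℝ} (hL : 0 ≤ κL)
    (hR : 0 ≤ κR) {N : ℕ} {t : ℝ} (ht : 0 ≤ t) {φ src Z Z' : ℝ → ℕ → ℕ → ℝ}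
    (h : IsPairFlow α κL κR N t φ src)
    (hZ : ∀ s ∈ Icc 0 t, ∀ x y, (x, y) ∈ pairs α N → HasDerivAt (fun r => Z r x y) (Z' s x y) s)
    (hZ' : ∀ s ∈ Icc 0 t, ∀ x y, (x, y) ∈ pairs α N →
      (N : ℝ) ^ 2 * (pairGen α κL κR N (Z s) x y + src s x y) ≤ Z' s x y)
    (h0 : ∀ x y, (x, y) ∈ pairs α N → φ 0 x y ≤ Z 0 x y) :
    ∀ x y, (x, y) ∈ pairs α N → φ t x y ≤ Z t x y := by
  have key := nonneg_of_deriv_nonneg_at_min (pairs α N) (T := t)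
    (fun r z => Z r z.1 z.2 - φ r z.1 z.2) (fun r z => Z' r z.1 z.2
      - (N : ℝ) ^ 2 * (pairGen α κL κR N (φ r) z.1 z.2 + src r z.1 z.2))
    (fun r hr z hz => (hZ r hr z.1 z.2 hz).sub (h r hr z.1 z.2 hz))
    (fun z hz => by linarith [h0 z.1 z.2 hz]) ?_ t ⟨ht, le_rfl⟩
  · intro x y hxy
    linarith [key (x, y) hxy]
  · rintro r hr ⟨x, y⟩ hz hneg hmin
    have h1 := hZ' r hr x y hz
    have h2 := pairGen_nonneg_of_min hα hL hR (u := fun x y => Z r x y + -1 * φ r x y) hz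
      (by simp only at hneg ⊢; linarith)
      (fun w hw => by have := hmin w hw; simp only at this ⊢; linarith)
    rw [pairGen_add α κL κR N (Z r) (fun x y => -1 * φ r x y), pairGen_const_mul] at h2
    have h3 := mul_nonneg (sq_nonneg (N : ℝ)) h2
    simp only
    linarith

/-- Upper bound for the pair equation, near the left boundary. -/
theorem IsPairFlow.le_left {α N : ℕ} (hα : 1 ≤ α) (hN : 2 ≤ N) {κL κR : ℝ} (hL : 0 < κL)
    (hR : 0 < κR) {t G K : ℝ} (ht : 0 < t) (hG : 0 ≤ G) (hK : 0 ≤ K)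
    {φ src : ℝ → ℕ → ℕ → ℝ} (h : IsPairFlow α κL κR N t φ src)
    (hsrc : ∀ s ∈ Icc 0 t, ∀ x y, (x, y) ∈ pairs α N →
      src s x y ≤ if y = x + 1 then G / (N : ℝ) ^ 2 else 0)
    (h0 : ∀ x y, (x, y) ∈ pairs α N → φ 0 x y ≤ K / N ∨
      (((x = 1 ∧ y = 1) ∨ (x = N - 1 ∧ y = N - 1)) ∧ φ 0 x y ≤ K))
    {m : ℕ} (hm : 1 ≤ m) (hmN : m < N) {x y : ℕ} (hxy : (x, y) ∈ pairs α N) :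
    φ t x y ≤ K / N * (Real.exp 1 * ((x + 1 / κL) / (N * √t)))
      + 2 * G / (N : ℝ) ^ 3 * ((x + 1 / κL) * (N - y + 1 / κR))
      + 2 * K * (1 / m + 2 * Real.exp (-(α * (N : ℝ) ^ 2 / (m : ℝ) ^ 2 * t))) ^ 2 := by
  have ha : (1 : ℝ) ≤ α := by exact_mod_cast hα
  have hN' : (2 : ℝ) ≤ N := by exact_mod_cast hN
  have hN0 : (0 : ℝ) < N := by linarith
  have hst : 0 < √t := Real.sqrt_pos.2 ht
  obtain ⟨f, hf, hf01, hfnn, hfle⟩ :=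
    exists_reflected_kernel (c := α * (N : ℝ) ^ 2) (by positivity) hN
  -- The inverse diffusive length at macroscopic time `t`. With `1 - r = δ` the decay rate of `r ^
  -- z` is at least `1/t`, as `hrt` records; truncation at `0` covers `δ > 1`.
  set δ := 1 / ((N : ℝ) * √t) with hδ
  have hδ0 : 0 < δ := by positivity
  have hδt : (N : ℝ) ^ 2 * t * δ ^ 2 = 1 := by
    rw [hδ]; field_simp; rw [Real.sq_sqrt ht.le]
  set r := max 0 (1 - δ) with hr
  have hr0 : 0 ≤ r := le_max_left _ _
  have hr1 : r < 1 := max_lt one_pos (by linarith)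
  have hrδ : 1 - r ≤ δ := by linarith [le_max_right 0 (1 - δ)]
  have hrt : r ≤ α * (N : ℝ) ^ 2 * t * (1 - r) ^ 2 := by
    rcases max_choice 0 (1 - δ) with e | e
    · rw [hr, e]; positivity
    · rw [← hr] at e
      have : (N : ℝ) ^ 2 * t * (1 - r) ^ 2 = 1 := by rw [e, sub_sub_cancel, hδt]
      have : α * (N : ℝ) ^ 2 * t * (1 - r) ^ 2 = α := by linear_combination (α : ℝ) * this
      linarith
  -- Chosen so that `w z = 1 - q r ^ z` satisfies the flux balance `κL w(0) = w(1) - w(0)`, which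
  -- yields the killing inequality at the site `1`.
  set q := κL / (κL + (1 - r)) with hq
  have hden : 0 < κL + (1 - r) := by linarith
  have hq0 : 0 ≤ q := by positivity
  have hq1 : q ≤ 1 := by rw [hq, div_le_one hden]; linarith
  have hqe : κL * (1 - q) = q * (1 - r) := by rw [hq]; field_simp; ring
  have hqr : q * (1 - r) ≤ κL * (1 - q * r) := by
    rw [← hqe]
    have : q * r ≤ q := mul_le_of_le_one_right hq0 hr1.le
    nlinarith
  let w : ℕ → ℝ := fun z => 1 - q * r ^ z
  have hw0 : ∀ z, 0 ≤ w z := by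
    intro z
    have h1 : r ^ z ≤ 1 := pow_le_one₀ hr0 hr1.le
    have h2 : 0 ≤ r ^ z := pow_nonneg hr0 z
    simp only [w]
    nlinarith
  have hwle : ∀ z : ℕ, w z ≤ (z + 1 / κL) / (N * √t) := by
    intro z
    have h1 : 1 - z * (1 - r) ≤ r ^ z := by
      have := one_add_mul_le_pow (a := r - 1) (by linarith) z
      rw [add_sub_cancel] at this
      linarith
    have h2 : 1 - q ≤ δ * (1 / κL) := by
      have : 1 - q = q * (1 - r) / κL := by rw [← hqe]; field_simp
      rw [this, mul_one_div]
      gcongr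
      nlinarith
    have h3 : (z + 1 / κL) / (N * √t) = δ * z + δ * (1 / κL) := by
      rw [hδ]; ring
    have h4 : q * (z * (1 - r)) ≤ δ * z := by
      have h5 : z * (1 - r) ≤ z * δ := mul_le_mul_of_nonneg_left hrδ (Nat.cast_nonneg z)
      have h6 : 0 ≤ z * (1 - r) := mul_nonneg (Nat.cast_nonneg z) (by linarith)
      nlinarith
    have h7 := mul_le_mul_of_nonneg_left h1 hq0
    rw [h3]
    simp only [w]
    linarith
  let H : ℕ → ℕ → ℝ := fun x y => ((x : ℝ) + 1 / κL) * ((N : ℝ) - y + 1 / κR)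
  have hHnn : ∀ x y, (x, y) ∈ pairs α N → 0 ≤ H x y := by
    intro x y hxy
    obtain ⟨h1, h2, h3, -⟩ := mem_pairs.1 hxy
    have : (y : ℝ) + 1 ≤ N := by exact_mod_cast (show y + 1 ≤ N by omega)
    have : 0 ≤ (N : ℝ) - y + 1 / κR := by
      have : 0 < 1 / κR := by positivity
      linarith
    simp only [H]
    positivity
  let fr : ℝ → ℕ → ℝ := fun s z => f s (N - z)
  have hfr : IsHeat (α * (N : ℝ) ^ 2) 0 0 N fr := hf.reflect
  have hfrnn : ∀ s, 0 ≤ s → ∀ z ∈ Finset.Icc 1 (N - 1), 0 ≤ fr s z := by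
    intro s hs z hz
    rw [Finset.mem_Icc] at hz
    exact hfnn s hs _ (Finset.mem_Icc.2 (by omega))
  -- The three pieces: survival, Green function, corners. The factor `exp (s/t) w + 1 - s/t` is at
  -- least `1` at time `0`, equals `e w` at time `t`, and is a supersolution in between although `w`
  -- alone does not dominate the constant `1`.
  let Z : ℝ → ℕ → ℕ → ℝ := fun s x y =>
    K / N * (Real.exp (s / t) * w x + (1 - s / t) * 1) + (2 * G / (N : ℝ) ^ 3 * H x y
      + (K * (f s x * f s y) + K * (fr s x * fr s y)))
  let Z' : ℝ → ℕ → ℕ → ℝ := fun s x y =>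
    K / N * (Real.exp (s / t) * (1 / t) * w x + (- (1 / t)) * 1)
      + (K * (α * (N : ℝ) ^ 2 * lap 0 0 N (f s) x * f s y
          + f s x * (α * (N : ℝ) ^ 2 * lap 0 0 N (f s) y))
        + K * (α * (N : ℝ) ^ 2 * lap 0 0 N (fr s) x * fr s y
          + fr s x * (α * (N : ℝ) ^ 2 * lap 0 0 N (fr s) y)))
  have main := h.le_of_supersolution hα hL.le hR.le ht.le (Z := Z) (Z' := Z') ?_ ?_ ?_ x y hxy
  · refine main.trans ?_
    obtain ⟨h1, h2, h3, -⟩ := mem_pairs.1 hxy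
    have hx : x ∈ Finset.Icc 1 (N - 1) := Finset.mem_Icc.2 (by omega)
    have hy : y ∈ Finset.Icc 1 (N - 1) := Finset.mem_Icc.2 (by omega)
    have hx' : N - x ∈ Finset.Icc 1 (N - 1) := Finset.mem_Icc.2 (by omega)
    have hy' : N - y ∈ Finset.Icc 1 (N - 1) := Finset.mem_Icc.2 (by omega)
    set b := 1 / (m : ℝ) + 2 * Real.exp (-(α * (N : ℝ) ^ 2 / (m : ℝ) ^ 2 * t)) with hb
    have hb0 : 0 ≤ b := by positivity
    have p1 : f t x * f t y ≤ b ^ 2 := by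
      rw [sq]
      exact mul_le_mul (hfle t ht.le m hm hmN x hx) (hfle t ht.le m hm hmN y hy)
        (hfnn t ht.le y hy) hb0
    have p2 : fr t x * fr t y ≤ b ^ 2 := by
      rw [sq]
      exact mul_le_mul (hfle t ht.le m hm hmN _ hx') (hfle t ht.le m hm hmN _ hy')
        (hfnn t ht.le _ hy') hb0
    have p3 := mul_le_mul_of_nonneg_left p1 hK
    have p4 := mul_le_mul_of_nonneg_left p2 hK
    have p5 : K / N * (Real.exp (t / t) * w x + (1 - t / t) * 1)
        ≤ K / N * (Real.exp 1 * ((x + 1 / κL) / (N * √t))) := by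
      rw [div_self ht.ne', sub_self, zero_mul, add_zero]
      have := hwle x
      gcongr
    simp only [Z, H]
    linarith
  · intro s _ x y hxy
    obtain ⟨h1, h2, h3, -⟩ := mem_pairs.1 hxy
    have hx : x ∈ Finset.Icc 1 (N - 1) := Finset.mem_Icc.2 (by omega)
    have hy : y ∈ Finset.Icc 1 (N - 1) := Finset.mem_Icc.2 (by omega)
    have d1 : HasDerivAt (fun s => K / N * (Real.exp (s / t) * w x + (1 - s / t) * 1))
        (K / N * (Real.exp (s / t) * (1 / t) * w x + (- (1 / t)) * 1)) s :=
      ((((hasDerivAt_id s).div_const t).exp.mul_const (w x)).add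
        ((((hasDerivAt_id s).div_const t).const_sub 1).mul_const 1)).const_mul (K / N)
    have d2 := ((hf s x hx).mul (hf s y hy)).const_mul K
    have d3 := ((hfr s x hx).mul (hfr s y hy)).const_mul K
    exact d1.add ((d2.add d3).const_add _)
  · intro s hs x y hxy
    obtain ⟨h1, h2, h3, -⟩ := mem_pairs.1 hxy
    have g1 : pairGen α κL κR N (fun z _ => w z) x y ≤ -(α * (q * r ^ (x - 1) * (1 - r) ^ 2)) :=
      pairGen_survival_le hα hR.le hr0 hr1.le hq0 hq1 hqr h1 h2
    have g2 : pairGen α κL κR N (fun _ _ => 1) x y ≤ 0 := pairGen_one_nonpos α hL.le hR.le N x y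
    have g3 : pairGen α κL κR N H x y ≤ if y = x + 1 then -((N : ℝ) - 1) else 0 := by
      refine pairGen_green_le hα (by positivity) (by positivity) ?_ ?_ h1 h2 h3
      · rw [mul_add, mul_one_div_cancel hL.ne']; linarith
      · rw [mul_add, mul_one_div_cancel hR.ne']; linarith
    have g4 := pairGen_tensor_le (α := α) hL.le hR.le (hfnn s hs.1) h1 h2 h3
    have g5 := pairGen_tensor_le (α := α) hL.le hR.le (hfrnn s hs.1) h1 h2 h3
    have lin : pairGen α κL κR N (Z s) x y
        = K / N * (Real.exp (s / t) * pairGen α κL κR N (fun z _ => w z) x y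
            + (1 - s / t) * pairGen α κL κR N (fun _ _ => 1) x y)
          + (2 * G / (N : ℝ) ^ 3 * pairGen α κL κR N H x y
          + (K * pairGen α κL κR N (fun x y => f s x * f s y) x y
            + K * pairGen α κL κR N (fun x y => fr s x * fr s y) x y)) := by
      simp only [Z, pairGen_add, pairGen_const_mul]
    have hst1 : s / t ≤ 1 := (div_le_one ht).2 hs.2
    have hE : 1 ≤ Real.exp (s / t) := Real.one_le_exp (div_nonneg hs.1 ht.le)
    have k1 : (N : ℝ) ^ 2 * (Real.exp (s / t) * pairGen α κL κR N (fun z _ => w z) x y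
            + (1 - s / t) * pairGen α κL κR N (fun _ _ => 1) x y)
        ≤ Real.exp (s / t) * (1 / t) * w x + (- (1 / t)) * 1 := by
      have a1 : (1 - s / t) * pairGen α κL κR N (fun _ _ => 1) x y ≤ 0 :=
        mul_nonpos_of_nonneg_of_nonpos (by linarith) g2
      have a2 : q * r ^ x ≤ t * ((N : ℝ) ^ 2 * (α * (q * r ^ (x - 1) * (1 - r) ^ 2))) := by
        have e : r ^ x = r ^ (x - 1) * r := by rw [← pow_succ]; congr 1; omega
        have := mul_le_mul_of_nonneg_left hrt (mul_nonneg hq0 (pow_nonneg hr0 (x - 1)))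
        rw [e]
        linarith
      have a3 : q * r ^ x / t ≤ (N : ℝ) ^ 2 * (α * (q * r ^ (x - 1) * (1 - r) ^ 2)) := by
        rw [div_le_iff₀ ht]; linarith
      have a4 : (N : ℝ) ^ 2 * pairGen α κL κR N (fun z _ => w z) x y ≤ -(q * r ^ x / t) := by
        have := mul_le_mul_of_nonneg_left g1 (sq_nonneg (N : ℝ))
        linarith
      have a5 := mul_le_mul_of_nonneg_left a4 (zero_le_one.trans hE)
      have a6 := mul_nonpos_of_nonneg_of_nonpos (sq_nonneg (N : ℝ)) a1
      -- The term `1 - s/t` supplies `-1/t`, which turns `w = 1 - q r ^ x` into the needed `-q r ^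
      -- x` up to the nonnegative remainder `(exp (s/t) - 1) / t`.
      have a7 : Real.exp (s / t) * (1 / t) * w x + (- (1 / t)) * 1
          = (Real.exp (s / t) - 1) / t + Real.exp (s / t) * -(q * r ^ x / t) := by
        simp only [w]; ring
      have a8 : 0 ≤ (Real.exp (s / t) - 1) / t := div_nonneg (by linarith) ht.le
      rw [a7]
      linarith
    have k2 : (N : ℝ) ^ 2 * (2 * G / (N : ℝ) ^ 3 * pairGen α κL κR N H x y + src s x y) ≤ 0 := by
      refine mul_nonpos_of_nonneg_of_nonpos (sq_nonneg _) ?_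
      have b1 := hsrc s hs x y hxy
      have b2 : 0 ≤ 2 * G / (N : ℝ) ^ 3 := by positivity
      split_ifs at b1 g3
      · have b3 := mul_le_mul_of_nonneg_left g3 b2
        -- The factor `2` in front of the Green function is needed because `2 (N - 1) ≥ N`, and only
        -- `N - 1` is available.
        have b4 : 2 * G / (N : ℝ) ^ 3 * -((N : ℝ) - 1) + G / (N : ℝ) ^ 2
            = -(G * (N - 2) / (N : ℝ) ^ 3) := by field_simp; ring
        have b5 : 0 ≤ G * (N - 2) / (N : ℝ) ^ 3 :=
          div_nonneg (mul_nonneg hG (by linarith)) (by positivity)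
        linarith
      · have b3 := mul_nonpos_of_nonneg_of_nonpos b2 g3
        linarith
    have k3 := mul_le_mul_of_nonneg_left k1 (show 0 ≤ K / N by positivity)
    have k4 := mul_le_mul_of_nonneg_left g4 (show 0 ≤ (N : ℝ) ^ 2 * K by positivity)
    have k5 := mul_le_mul_of_nonneg_left g5 (show 0 ≤ (N : ℝ) ^ 2 * K by positivity)
    rw [lin]
    simp only [Z']
    linarith
  · intro x y hxy
    obtain ⟨h1, h2, h3, -⟩ := mem_pairs.1 hxy
    have hx : x ∈ Finset.Icc 1 (N - 1) := Finset.mem_Icc.2 (by omega)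
    have hy : y ∈ Finset.Icc 1 (N - 1) := Finset.mem_Icc.2 (by omega)
    have p1 : 0 ≤ K / N * w x := mul_nonneg (by positivity) (hw0 x)
    have p2 : 0 ≤ 2 * G / (N : ℝ) ^ 3 * H x y := mul_nonneg (by positivity) (hHnn x y hxy)
    have p3 : 0 ≤ K * (f 0 x * f 0 y) :=
      mul_nonneg hK (mul_nonneg (hfnn 0 le_rfl x hx) (hfnn 0 le_rfl y hy))
    have p4 : 0 ≤ K * (fr 0 x * fr 0 y) :=
      mul_nonneg hK (mul_nonneg (hfrnn 0 le_rfl x hx) (hfrnn 0 le_rfl y hy))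
    have p5 : 0 ≤ K / N := by positivity
    have hZ0 : Z 0 x y = K / N * w x + K / N + (2 * G / (N : ℝ) ^ 3 * H x y
      + (K * (f 0 x * f 0 y) + K * (fr 0 x * fr 0 y))) := by
      simp only [Z, zero_div, Real.exp_zero]; ring
    rw [hZ0]
    rcases h0 x y hxy with h | ⟨⟨rfl, rfl⟩ | ⟨hx1, hy1⟩, h⟩
    · linarith
    · rw [hf01, mul_one, mul_one] at *
      linarith
    · have e : fr 0 x * fr 0 y = 1 := by
        simp only [fr]
        rw [hx1, hy1, Nat.sub_sub_self (by omega), hf01, mul_one]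
      rw [e] at *
      linarith

/-- Bounds for the pair equation near both ends. -/
theorem IsPairFlow.abs_le {α N : ℕ} (hα : 1 ≤ α) (hN : 2 ≤ N) {κL κR : ℝ} (hL : 0 < κL)
    (hR : 0 < κR) {t G K : ℝ} (ht : 0 < t) (hG : 0 ≤ G) (hK : 0 ≤ K)
    {φ src : ℝ → ℕ → ℕ → ℝ} (h : IsPairFlow α κL κR N t φ src)
    (hsrc : ∀ s ∈ Icc 0 t, ∀ x y, (x, y) ∈ pairs α N →
      |src s x y| ≤ if y = x + 1 then G / (N : ℝ) ^ 2 else 0)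
    (h0 : ∀ x y, (x, y) ∈ pairs α N → |φ 0 x y| ≤ K / N ∨
      (((x = 1 ∧ y = 1) ∨ (x = N - 1 ∧ y = N - 1)) ∧ |φ 0 x y| ≤ K))
    {m : ℕ} (hm : 1 ≤ m) (hmN : m < N) {x y : ℕ} (hxy : (x, y) ∈ pairs α N) :
    |φ t x y| ≤ K / N * (Real.exp 1 * ((x + 1 / κL) / (N * √t)))
      + 2 * G / (N : ℝ) ^ 3 * ((x + 1 / κL) * (N - y + 1 / κR))
      + 2 * K * (1 / m + 2 * Real.exp (-(α * (N : ℝ) ^ 2 / (m : ℝ) ^ 2 * t))) ^ 2 := by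
  refine abs_le'.2 ⟨h.le_left hα hN hL hR ht hG hK (fun s hs x y hz => ?_) (fun x y hz => ?_)
    hm hmN hxy, ?_⟩
  · exact (le_abs_self _).trans (hsrc s hs x y hz)
  · exact (h0 x y hz).imp (le_abs_self _).trans (And.imp_right (le_abs_self _).trans)
  · rw [← neg_one_mul]
    refine h.neg.le_left hα hN hL hR ht hG hK (fun s hs x y hz => ?_) (fun x y hz => ?_) hm hmN hxy
    · rw [neg_one_mul]
      exact (neg_le_abs _).trans (hsrc s hs x y hz)
    · simp only [neg_one_mul]
      exact (h0 x y hz).imp (neg_le_abs _).trans (And.imp_right (neg_le_abs _).trans)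

theorem IsPairFlow.abs_le_right {α N : ℕ} (hα : 1 ≤ α) (hN : 2 ≤ N) {κL κR : ℝ} (hL : 0 < κL)
    (hR : 0 < κR) {t G K : ℝ} (ht : 0 < t) (hG : 0 ≤ G) (hK : 0 ≤ K)
    {φ src : ℝ → ℕ → ℕ → ℝ} (h : IsPairFlow α κL κR N t φ src)
    (hsrc : ∀ s ∈ Icc 0 t, ∀ x y, (x, y) ∈ pairs α N →
      |src s x y| ≤ if y = x + 1 then G / (N : ℝ) ^ 2 else 0)
    (h0 : ∀ x y, (x, y) ∈ pairs α N → |φ 0 x y| ≤ K / N ∨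
      (((x = 1 ∧ y = 1) ∨ (x = N - 1 ∧ y = N - 1)) ∧ |φ 0 x y| ≤ K))
    {m : ℕ} (hm : 1 ≤ m) (hmN : m < N) {x y : ℕ} (hxy : (x, y) ∈ pairs α N) :
    |φ t x y| ≤ K / N * (Real.exp 1 * ((N - y + 1 / κR) / (N * √t)))
      + 2 * G / (N : ℝ) ^ 3 * ((N - y + 1 / κR) * (x + 1 / κL))
      + 2 * K * (1 / m + 2 * Real.exp (-(α * (N : ℝ) ^ 2 / (m : ℝ) ^ 2 * t))) ^ 2 := by
  have hz := mem_pairs.1 hxy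
  have key := h.reflect.abs_le hα hN hR hL ht hG hK (fun s hs x y hz => ?_) (fun x y hz => ?_)
    hm hmN (reflect_mem_pairs hxy)
  · simp only [Nat.sub_sub_self (show x ≤ N by omega), Nat.sub_sub_self (show y ≤ N by omega)] at key
    rw [Nat.cast_sub (show y ≤ N by omega), Nat.cast_sub (show x ≤ N by omega), sub_sub_cancel]
      at key
    exact key
  · have := hsrc s hs _ _ (reflect_mem_pairs hz)
    have hz := mem_pairs.1 hz
    refine this.trans (le_of_eq ?_)
    congr 1
    exact propext (by omega)
  · have := h0 _ _ (reflect_mem_pairs hz)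
    have hz := mem_pairs.1 hz
    refine this.imp_right (And.imp_left ?_)
    omega

end SEP

/-! ### The generator on linear and quadratic functions of the occupation variables. -/

namespace SEP

open Set

section Generator

variable {α N : ℕ}

theorem occ_single_move {x y : Site N} (hxy : x ≠ y) {η : Config α N} (hx : (η x : ℕ) ≠ 0)
    (hy : (η y : ℕ) ≠ α) :
    occ (η + delta y - delta x) = occ η + Pi.single y 1 - Pi.single x 1 := by
  ext z
  simp only [occ, delta, Pi.add_apply, Pi.sub_apply, Pi.single_apply]
  have hα : 1 ≤ α := by have := (η x).2; omega
  by_cases hzx : z = x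
  · subst hzx
    rw [if_neg hxy, if_neg hxy, if_pos rfl, if_pos rfl, add_zero, add_zero]
    rw [Fin.val_sub_one_of_ne_zero (fun h => hx (by rw [h]; rfl)), Nat.cast_sub (by omega)]
    simp
  · rw [if_neg hzx, if_neg hzx, sub_zero, sub_zero]
    by_cases hzy : z = y
    · subst hzy
      rw [if_pos rfl, if_pos rfl, Fin.val_add_one_of_lt]
      · push_cast; rfl
      · rw [Fin.lt_def, Fin.val_last]
        have := (η z).2
        omega
    · rw [if_neg hzy, if_neg hzy, add_zero, add_zero]

theorem occ_single_add {x : Site N} {η : Config α N} (hx : (η x : ℕ) ≠ α) :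
    occ (η + delta x) = occ η + Pi.single x 1 := by
  ext z
  simp only [occ, delta, Pi.add_apply, Pi.single_apply]
  by_cases hzy : z = x
  · subst hzy
    rw [if_pos rfl, if_pos rfl, Fin.val_add_one_of_lt]
    · push_cast; rfl
    · rw [Fin.lt_def, Fin.val_last]
      have := (η z).2
      omega
  · rw [if_neg hzy, if_neg hzy, add_zero, add_zero]

theorem occ_single_sub {x : Site N} {η : Config α N} (hx : (η x : ℕ) ≠ 0) :
    occ (η - delta x) = occ η - Pi.single x 1 := by
  ext z
  simp only [occ, delta, Pi.sub_apply, Pi.single_apply]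
  have hα : 1 ≤ α := by have := (η x).2; omega
  by_cases hzx : z = x
  · subst hzx
    rw [if_pos rfl, if_pos rfl,
      Fin.val_sub_one_of_ne_zero (fun h => hx (by rw [h]; rfl)), Nat.cast_sub (by omega)]
    simp
  · rw [if_neg hzx, if_neg hzx, sub_zero, sub_zero]

/-- The rate vanishes exactly when addition in `Fin (α + 1)` could wrap around, so jumps may be
computed with real occupation variables. -/
theorem rate_move (Ψ : (Site N → ℝ) → ℝ) {x y : Site N} (hxy : x ≠ y) (η : Config α N) :
    occ η x * (α - occ η y) * (Ψ (occ (η + delta y - delta x)) - Ψ (occ η))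
      = occ η x * (α - occ η y) * (Ψ (occ η + Pi.single y 1 - Pi.single x 1) - Ψ (occ η)) := by
  by_cases hx : (η x : ℕ) = 0
  · simp [occ, hx]
  by_cases hy : (η y : ℕ) = α
  · simp [occ, hy]
  rw [occ_single_move hxy hx hy]

theorem rate_add (Ψ : (Site N → ℝ) → ℝ) (x : Site N) (η : Config α N) :
    (α - occ η x) * (Ψ (occ (η + delta x)) - Ψ (occ η))
      = (α - occ η x) * (Ψ (occ η + Pi.single x 1) - Ψ (occ η)) := by
  by_cases hx : (η x : ℕ) = α
  · simp [occ, hx]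
  rw [occ_single_add hx]

theorem rate_sub (Ψ : (Site N → ℝ) → ℝ) (x : Site N) (η : Config α N) :
    occ η x * (Ψ (occ (η - delta x)) - Ψ (occ η))
      = occ η x * (Ψ (occ η - Pi.single x 1) - Ψ (occ η)) := by
  by_cases hx : (η x : ℕ) = 0
  · simp [occ, hx]
  rw [occ_single_sub hx]

/-- The discrete divergence of a function on bonds, with no flux through the boundary. -/
def bondDiv (N : ℕ) (b : ℕ → ℝ) (z : ℕ) : ℝ :=
  (if z = 1 then 0 else b (z - 1)) - if z + 1 = N then 0 else b z

/-- The increment at `z` of a jump along the bond from `x` to `x + 1`. -/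
def jump (z x : ℕ) : ℝ := (if z = x + 1 then 1 else 0) - if z = x then 1 else 0

/-- Only the two bonds at `z` change the occupation of `z`; the conditions in `bondDiv` remove the
bond missing at an end site. -/
theorem sum_bonds_jump (b : ℕ → ℝ) (z : Site N) :
    (∑ x : Site N, ∑ y : Site N, if (y : ℕ) = x + 1 then b x * jump z x else 0)
      = bondDiv N b z := by
  have hz := Finset.mem_Icc.1 z.2
  have h1 : (∑ x : Site N, ∑ y : Site N,
      if (y : ℕ) = x + 1 then b x * (if (z : ℕ) = x + 1 then 1 else 0) else 0)
      = if (z : ℕ) = 1 then 0 else b (z - 1) := by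
    split_ifs with h
    · refine Finset.sum_eq_zero fun x _ => Finset.sum_eq_zero fun y _ => ?_
      have hx := Finset.mem_Icc.1 x.2
      rw [if_neg (show ¬(z : ℕ) = x + 1 by omega), mul_zero, ite_self]
    · rw [Finset.sum_eq_single (⟨z - 1, Finset.mem_Icc.2 (by omega)⟩ : Site N),
        Finset.sum_eq_single z]
      · simp only
        rw [if_pos (by omega), if_pos (by omega), mul_one]
      · intro y _ hy
        rw [if_neg]
        intro e
        exact hy (Subtype.ext (by simp only at e; omega))
      · simp
      · intro x _ hx
        refine Finset.sum_eq_zero fun y _ => ?_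
        rw [if_neg (show ¬(z : ℕ) = x + 1 from fun e => hx (Subtype.ext (by simp only; omega))),
          mul_zero, ite_self]
      · simp
  have h2 : (∑ x : Site N, ∑ y : Site N,
      if (y : ℕ) = x + 1 then b x * (if (z : ℕ) = x then 1 else 0) else 0)
      = if (z : ℕ) + 1 = N then 0 else b z := by
    rw [Finset.sum_eq_single z]
    · simp only [if_true, mul_one]
      split_ifs with h
      · refine Finset.sum_eq_zero fun y _ => ?_
        have hy := Finset.mem_Icc.1 y.2
        rw [if_neg (by omega)]
      · rw [Finset.sum_eq_single (⟨z + 1, Finset.mem_Icc.2 (by omega)⟩ : Site N)]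
        · simp
        · intro y _ hy
          rw [if_neg]
          exact fun e => hy (Subtype.ext e)
        · simp
    · intro x _ hx
      refine Finset.sum_eq_zero fun y _ => ?_
      rw [if_neg (show ¬(z : ℕ) = x from fun e => hx (Subtype.ext e.symm)), mul_zero, ite_self]
    · simp
  rw [bondDiv, ← h1, ← h2, ← Finset.sum_sub_distrib]
  refine Finset.sum_congr rfl fun x _ => ?_
  rw [← Finset.sum_sub_distrib]
  refine Finset.sum_congr rfl fun y _ => ?_
  by_cases h : (y : ℕ) = x + 1
  · rw [if_pos h, if_pos h, if_pos h, jump]; ring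
  · rw [if_neg h, if_neg h, if_neg h]; ring

theorem single_sub_single {x y : Site N} (hxy : (y : ℕ) = x + 1) (z : Site N) :
    (Pi.single y 1 : Site N → ℝ) z - (Pi.single x 1 : Site N → ℝ) z = jump z x := by
  simp only [Pi.single_apply, jump, Subtype.ext_iff, hxy]

/-- The current through the bond from `x` to `x + 1`. -/
def current (α : ℕ) (a : ℕ → ℝ) (x : ℕ) : ℝ := α * (a x - a (x + 1))

/-- The total rate of jumps along the bond between `x` and `x + 1`. -/
def activity (α : ℕ) (a : ℕ → ℝ) (x : ℕ) : ℝ :=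
  a x * (α - a (x + 1)) + a (x + 1) * (α - a x)

theorem genBulk_occ (η : Config α N) (z : Site N) :
    genBulk (fun ξ => occ ξ z) η = bondDiv N (current α (extend (occ η))) z := by
  rw [← sum_bonds_jump, genBulk]
  refine Finset.sum_congr rfl fun x _ => Finset.sum_congr rfl fun y _ => ?_
  by_cases h : (y : ℕ) = x + 1
  · have hne : x ≠ y := fun e => by rw [e] at h; omega
    rw [if_pos h, if_pos h, rate_move (fun u => u z) hne η, rate_move (fun u => u z) hne.symm η]
    simp only [current, ← h, extend_coe, Pi.add_apply, Pi.sub_apply]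
    rw [← single_sub_single h]
    ring
  · rw [if_neg h, if_neg h]

/-- Leibniz rule with a carré du champ: each jump adds the product of the two increments, weighted
by the activity of the bond. -/
theorem genBulk_occ_mul_occ (η : Config α N) (z w : Site N) :
    genBulk (fun ξ => occ ξ z * occ ξ w) η
      = bondDiv N (current α (extend (occ η))) z * occ η w
        + occ η z * bondDiv N (current α (extend (occ η))) w
        + bondDiv N (fun x => activity α (extend (occ η)) x * jump w x) z := by
  rw [← sum_bonds_jump, ← sum_bonds_jump, ← sum_bonds_jump, genBulk, Finset.sum_mul,
    Finset.mul_sum, ← Finset.sum_add_distrib, ← Finset.sum_add_distrib]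
  refine Finset.sum_congr rfl fun x _ => ?_
  rw [Finset.sum_mul, Finset.mul_sum, ← Finset.sum_add_distrib, ← Finset.sum_add_distrib]
  refine Finset.sum_congr rfl fun y _ => ?_
  by_cases h : (y : ℕ) = x + 1
  · have hne : x ≠ y := fun e => by rw [e] at h; omega
    simp only [if_pos h]
    rw [rate_move (fun u => u z * u w) hne η, rate_move (fun u => u z * u w) hne.symm η]
    simp only [current, activity, ← h, extend_coe, Pi.add_apply, Pi.sub_apply]
    rw [← single_sub_single h, ← single_sub_single h]
    ring
  · simp only [if_neg h]
    ring

theorem genReservoir_occ (lam rho : ℝ) (x : Site N) (η : Config α N) (z : Site N) :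
    genReservoir lam rho x (fun ξ => occ ξ z) η
      = if z = x then α * (lam * (rho - occ η z)) else 0 := by
  have h1 := rate_add (fun u => u z) x η
  have h2 := rate_sub (fun u => u z) x η
  rw [genReservoir, mul_assoc (lam * rho), h1, mul_assoc (lam * _), h2]
  simp only [Pi.add_apply, Pi.sub_apply, Pi.single_apply]
  split_ifs with h
  · rw [h]; ring
  · ring

theorem genReservoir_occ_mul_occ (lam rho : ℝ) (x : Site N) (η : Config α N) (z w : Site N) :
    genReservoir lam rho x (fun ξ => occ ξ z * occ ξ w) η
      = (if z = x then α * (lam * (rho - occ η z)) else 0) * occ η w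
        + occ η z * (if w = x then α * (lam * (rho - occ η w)) else 0)
        + if z = x ∧ w = x then lam * (rho * (α - occ η z) + (α - rho) * occ η z) else 0 := by
  have h1 := rate_add (fun u => u z * u w) x η
  have h2 := rate_sub (fun u => u z * u w) x η
  rw [genReservoir, mul_assoc (lam * rho), h1, mul_assoc (lam * _), h2]
  simp only [Pi.add_apply, Pi.sub_apply, Pi.single_apply]
  by_cases hz : z = x <;> by_cases hw : w = x
  · subst hz; subst hw; simp; ring
  · subst hz; simp [hw]; ring
  · subst hw; simp [hz]; ring
  · simp [hz, hw]

end Generator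

end SEP

/-! ### Self-duality. -/

namespace SEP

open Set

/-- The intensity `λ^ℓ N^{-θ}` of the killing at the left boundary. -/
noncomputable def killL (p : Params) (N : ℕ) : ℝ := p.lamL / (N : ℝ) ^ p.θ

/-- The intensity `λ^r N^{-θ}` of the killing at the right boundary. -/
noncomputable def killR (p : Params) (N : ℕ) : ℝ := p.lamR / (N : ℝ) ^ p.θ

/-- The microscopic drift of a density `r`. -/
noncomputable def drift (p : Params) (N : ℕ) (r : ℕ → ℝ) (z : ℕ) : ℝ :=
  p.α * (lap (killL p N) (killR p N) N r z + ((if z = 1 then killL p N * p.rhoL else 0)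
    + if z + 1 = N then killR p N * p.rhoR else 0))

/-- The inhomogeneous boundary terms in the evolution of the two-point function. -/
noncomputable def pairSource (p : Params) (N : ℕ) (r : ℕ → ℝ) (z w : ℕ) : ℝ :=
  (if z = w then 2 else 1) * (p.α * ((if z = 1 then killL p N * p.rhoL * r w else 0)
    + if w + 1 = N then killR p N * p.rhoR * r z else 0))

/-- The duality function of two particles: `a x * a y` off the diagonal, and the falling factorial
`α a (a - 1) / (α - 1)` on it. -/
noncomputable def pairDual (α : ℕ) (a : ℕ → ℝ) (x y : ℕ) : ℝ :=
  if x = y then α * (a x * (a x - 1)) / (α - 1) else a x * a y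

theorem sum_site_ite {N : ℕ} (k : ℕ) (z : Site N) (c : ℝ) :
    (∑ x : Site N, if (x : ℕ) = k then (if z = x then c else 0) else 0)
      = if (z : ℕ) = k then c else 0 := by
  rw [Finset.sum_eq_single z]
  · simp
  · intro x _ hx
    rw [if_neg (show ¬z = x from fun e => hx e.symm), ite_self]
  · simp

theorem gen_occ (p : Params) (N : ℕ) (η : Config p.α N) (z : Site N) :
    gen p N (fun ξ => occ ξ z) η = drift p N (extend (occ η)) z := by
  have hz := Finset.mem_Icc.1 z.2
  have hzN : (z : ℕ) = N - 1 ↔ (z : ℕ) + 1 = N := by omega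
  simp only [gen, genBulk_occ, genReservoir_occ, sum_site_ite, hzN, drift, lap, diffLeft,
    diffRight, bondDiv, current, extend_coe, killL, killR]
  rw [Nat.sub_add_cancel hz.1]
  simp only [extend_coe]
  split_ifs <;> ring

theorem gen_occ_mul_occ (p : Params) (N : ℕ) (η : Config p.α N) (z w : Site N) :
    gen p N (fun ξ => occ ξ z * occ ξ w) η
      = drift p N (extend (occ η)) z * occ η w + occ η z * drift p N (extend (occ η)) w
        + (bondDiv N (fun x => activity p.α (extend (occ η)) x * jump w x) z
        + if z = w then
            (if (z : ℕ) = 1 then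
              killL p N * (p.rhoL * (p.α - occ η z) + (p.α - p.rhoL) * occ η z) else 0)
            + (if (z : ℕ) + 1 = N then
              killR p N * (p.rhoR * (p.α - occ η z) + (p.α - p.rhoR) * occ η z) else 0)
          else 0) := by
  have hz := Finset.mem_Icc.1 z.2
  have hzN : (z : ℕ) = N - 1 ↔ (z : ℕ) + 1 = N := by omega
  have hsum : ∀ (k : ℕ) (lam rho : ℝ),
      (∑ x : Site N, if (x : ℕ) = k then
        genReservoir lam rho x (fun ξ => occ ξ z * occ ξ w) η else 0)
      = (∑ x : Site N, if (x : ℕ) = k then genReservoir lam rho x (fun ξ => occ ξ z) η else 0)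
          * occ η w
        + occ η z * (∑ x : Site N, if (x : ℕ) = k then
            genReservoir lam rho x (fun ξ => occ ξ w) η else 0)
        + if z = w then (if (z : ℕ) = k then
            lam * (rho * (p.α - occ η z) + (p.α - rho) * occ η z) else 0) else 0 := by
    intro k lam rho
    have h3 : (if z = w then (if (z : ℕ) = k then
        lam * (rho * (p.α - occ η z) + (p.α - rho) * occ η z) else 0) else 0)
        = ∑ x : Site N, if (x : ℕ) = k then (if z = x ∧ w = x then
            lam * (rho * (p.α - occ η z) + (p.α - rho) * occ η z) else 0) else 0 := by
      split_ifs with h1 h2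
      · subst h1
        simp only [and_self]
        rw [sum_site_ite, if_pos h2]
      · subst h1
        simp only [and_self]
        rw [sum_site_ite, if_neg h2]
      · refine (Finset.sum_eq_zero fun x _ => ?_).symm
        rw [if_neg (show ¬(z = x ∧ w = x) from fun e => h1 (e.1.trans e.2.symm)), ite_self]
    rw [h3, Finset.sum_mul, Finset.mul_sum, ← Finset.sum_add_distrib, ← Finset.sum_add_distrib]
    refine Finset.sum_congr rfl fun x _ => ?_
    by_cases h : (x : ℕ) = k
    · simp only [if_pos h, genReservoir_occ_mul_occ, genReservoir_occ]
    · simp only [if_neg h]; ring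
  rw [← gen_occ, ← gen_occ, gen, gen, gen, hsum, hsum, genBulk_occ_mul_occ, genBulk_occ,
    genBulk_occ]
  simp only [hzN, killL, killR]
  split_ifs <;> ring

/-- Removes the denominator also for `α = 1`: the left side then vanishes by its factor, and the
right side because occupations are `0` or `1`. -/
theorem pairDual_self_mul {α N : ℕ} (hα : 1 ≤ α) (η : Config α N) {x : ℕ}
    (hx : x ∈ Finset.Icc 1 (N - 1)) :
    ((α : ℝ) - 1) * pairDual α (extend (occ η)) x x
      = α * (extend (occ η) x * (extend (occ η) x - 1)) := by
  rw [pairDual, if_pos rfl]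
  rcases eq_or_lt_of_le hα with h | h
  · subst h
    rw [extend_of_mem _ hx, occ]
    have := (η ⟨x, hx⟩).2
    have h2 : (η ⟨x, hx⟩ : ℕ) = 0 ∨ (η ⟨x, hx⟩ : ℕ) = 1 := by omega
    rcases h2 with h2 | h2 <;> simp [h2]
  · have : (1 : ℝ) < α := by exact_mod_cast h
    have : (α : ℝ) - 1 ≠ 0 := by linarith
    field_simp

/-- The drift of a product of densities. -/
theorem drift_mul_add_mul_drift (p : Params) (N : ℕ) (r : ℕ → ℝ) {z w : ℕ} (hz : 1 ≤ z)
    (hzw : z ≤ w) (hw : w ≤ N - 1) :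
    drift p N r z * r w + r z * drift p N r w
      = pairGen p.α (killL p N) (killR p N) N (fun x y => r x * r y) z w
        + ((if w = z + 1 then (r (z + 1) - r z) ^ 2 else 0) + pairSource p N r z w) := by
  simp only [drift, pairGen, pairSource, lap, diffLeft_mul_const, diffRight_const_mul]
  rcases eq_or_lt_of_le hzw with h | h
  · subst h
    simp only [if_true, if_neg (show ¬z = z + 1 by omega)]
    split_ifs <;> ring
  · have e1 : diffRight (killR p N) N r z = r (z + 1) - r z := by
      rw [diffRight, if_neg (by omega)]
    -- The inner differences do not see the reservoirs. For neighbours the product rule for two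
    -- independent walks differs from `pairGen` by the square of the gradient.
    have e2 : diffLeft (killL p N) r w = r (w - 1) - r w := by rw [diffLeft, if_neg (by omega)]
    rw [e1, e2]
    simp only [if_neg h.ne, if_neg (show ¬z + 1 = N by omega), if_neg (show ¬w = 1 by omega)]
    by_cases h2 : w = z + 1
    · subst h2
      simp only [if_true, Nat.add_sub_cancel]
      split_ifs <;> ring
    · simp only [if_neg h2]
      split_ifs <;> ring

/-- The generator, as a linear map. -/
noncomputable def genLin (p : Params) (N : ℕ) :
    (Config p.α N → ℝ) →ₗ[ℝ] (Config p.α N → ℝ) where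
  toFun := gen p N
  map_add' f g := by
    ext η
    have hs : ∀ k lam rho, (∑ x : Site N, if (x : ℕ) = k then
        genReservoir lam rho x (f + g) η else 0)
        = (∑ x : Site N, if (x : ℕ) = k then genReservoir lam rho x f η else 0)
          + ∑ x : Site N, if (x : ℕ) = k then genReservoir lam rho x g η else 0 := by
      intro k lam rho
      rw [← Finset.sum_add_distrib]
      refine Finset.sum_congr rfl fun x _ => ?_
      simp only [genReservoir, Pi.add_apply]
      split_ifs <;> ring
    have hb : genBulk (f + g) η = genBulk f η + genBulk g η := by
      simp only [genBulk, ← Finset.sum_add_distrib, Pi.add_apply]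
      refine Finset.sum_congr rfl fun x _ => Finset.sum_congr rfl fun y _ => ?_
      split_ifs <;> ring
    simp only [gen, Pi.add_apply, hs, hb]
    ring
  map_smul' c f := by
    ext η
    simp only [gen, genBulk, genReservoir, Pi.smul_apply, smul_eq_mul, RingHom.id_apply, mul_add,
      Finset.mul_sum]
    congr 1
    · refine Finset.sum_congr rfl fun x _ => Finset.sum_congr rfl fun y _ => ?_
      split_ifs <;> ring
    · congr 1
      · refine Finset.sum_congr rfl fun x _ => ?_
        split_ifs <;> ring
      · refine Finset.sum_congr rfl fun x _ => ?_
        split_ifs <;> ring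

/-- Self-duality for two particles. -/
theorem gen_pairDual (p : Params) (hα : 1 ≤ p.α) (N : ℕ) (η : Config p.α N) {z w : ℕ}
    (h : (z, w) ∈ pairs p.α N) :
    gen p N (fun ξ => pairDual p.α (extend (occ ξ)) z w) η
      = pairGen p.α (killL p N) (killR p N) N (pairDual p.α (extend (occ η))) z w
        + pairSource p N (extend (occ η)) z w := by
  obtain ⟨hz, hzw, hw, hd⟩ := mem_pairs.1 h
  have hzm : z ∈ Finset.Icc 1 (N - 1) := Finset.mem_Icc.2 (by omega)
  have hwm : w ∈ Finset.Icc 1 (N - 1) := Finset.mem_Icc.2 (by omega)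
  set a := extend (occ η) with ha
  rcases eq_or_lt_of_le hzw with e | hlt
  · subst e
    have hα2 : (1 : ℝ) < p.α := by
      have := hd rfl
      exact_mod_cast (show 1 < p.α by omega)
    have hα0 : (p.α : ℝ) - 1 ≠ 0 := by linarith
    -- On the diagonal the duality function is a combination of `η(z)²` and `η(z)`, whose generators
    -- are known.
    have hfun : (fun ξ : Config p.α N => pairDual p.α (extend (occ ξ)) z z)
        = ((p.α : ℝ) / (p.α - 1)) • (fun ξ => occ ξ ⟨z, hzm⟩ * occ ξ ⟨z, hzm⟩)
          + (-((p.α : ℝ) / (p.α - 1))) • fun ξ => occ ξ ⟨z, hzm⟩ := by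
      ext ξ
      simp only [pairDual, if_true, extend_of_mem _ hzm, Pi.add_apply, Pi.smul_apply, smul_eq_mul]
      ring
    have hgen : gen p N (fun ξ => pairDual p.α (extend (occ ξ)) z z) η
        = ((p.α : ℝ) / (p.α - 1)) * gen p N (fun ξ => occ ξ ⟨z, hzm⟩ * occ ξ ⟨z, hzm⟩) η
          + (-((p.α : ℝ) / (p.α - 1))) * gen p N (fun ξ => occ ξ ⟨z, hzm⟩) η := by
      have := congrFun (congrArg (genLin p N) hfun) η
      rw [map_add, map_smul, map_smul] at this
      exact this
    have hoz : occ η ⟨z, hzm⟩ = a z := (extend_of_mem _ hzm).symm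
    have hzz : z - 1 + 1 = z := by omega
    have hz1 : z ≠ z - 1 := by omega
    have hz2 : z ≠ z + 1 := by omega
    have hz3 : z - 1 ≠ z := by omega
    rw [hgen, gen_occ_mul_occ, gen_occ]
    simp only [hoz, ← ha, if_true, drift, pairGen, pairSource, lap, diffLeft, diffRight, bondDiv,
      jump, activity, hzz, if_neg hz1, if_neg hz2, pairDual, if_neg hz3]
    split_ifs with h1 h2
    all_goals
      field_simp
      ring
  · have hfun : (fun ξ : Config p.α N => pairDual p.α (extend (occ ξ)) z w)
        = fun ξ => occ ξ ⟨z, hzm⟩ * occ ξ ⟨w, hwm⟩ := by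
      ext ξ
      simp only [pairDual, if_neg hlt.ne, extend_of_mem _ hzm, extend_of_mem _ hwm]
    have hoz : occ η ⟨z, hzm⟩ = a z := (extend_of_mem _ hzm).symm
    have how : occ η ⟨w, hwm⟩ = a w := (extend_of_mem _ hwm).symm
    have hne : ¬(⟨z, hzm⟩ : Site N) = ⟨w, hwm⟩ := fun e => hlt.ne (congrArg Subtype.val e)
    rw [hfun, gen_occ_mul_occ, hoz, how, ← ha, drift_mul_add_mul_drift p N a hz hzw hw,
      if_neg hne, add_zero]
    have hb : bondDiv N (fun x => activity p.α a x * jump w x) z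
        = if w = z + 1 then -activity p.α a z else 0 := by
      rw [bondDiv, if_neg (show ¬z + 1 = N by omega)]
      have j1 : jump w (z - 1) = 0 := by
        rw [jump, if_neg (by omega), if_neg (by omega), sub_zero]
      have j2 : jump w z = if w = z + 1 then 1 else 0 := by
        rw [jump, if_neg (show ¬w = z by omega), sub_zero]
      simp only [j1, j2]
      split_ifs <;> ring
    simp only [hb]
    have hL : diffLeft (killL p N) (fun x => pairDual p.α a x w) z
        = diffLeft (killL p N) (fun x => a x * a w) z := by
      simp only [diffLeft, pairDual, if_neg hlt.ne, if_neg (show ¬z - 1 = w by omega)]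
    have hR : diffRight (killR p N) N (pairDual p.α a z) w
        = diffRight (killR p N) N (fun y => a z * a y) w := by
      simp only [diffRight, pairDual, if_neg hlt.ne, if_neg (show ¬z = w + 1 by omega)]
    simp only [pairGen, hL, hR, if_neg hlt.ne]
    by_cases hn : w = z + 1
    · have d1 := pairDual_self_mul hα η hzm
      have d2 := pairDual_self_mul hα η hwm
      rw [← ha] at d1 d2
      have d3 : pairDual p.α a z w = a z * a w := by rw [pairDual, if_neg hlt.ne]
      simp only [if_pos hn, activity, d3]
      rw [← hn]
      -- The squared gradient and the activity combine into falling factorials at both sites; this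
      -- fixes the diagonal values of `pairDual`.
      linear_combination -d1 - d2
    · simp only [if_neg hn, pairDual, if_neg hlt.ne, if_neg (show ¬z + 1 = w by omega),
        if_neg (show ¬z = w - 1 by omega)]
      ring

end SEP

/-! ### Expectations, and the closed equation for the correlations. -/

namespace SEP

open Set MeasureTheory

theorem genMatrix_eq (p : Params) (N : ℕ) : genMatrix p N = LinearMap.toMatrix' (genLin p N) := by
  ext η ξ
  rw [LinearMap.toMatrix'_apply]
  rfl

theorem genMatrix_mulVec (p : Params) (N : ℕ) (f : Config p.α N → ℝ) :
    (genMatrix p N).mulVec f = gen p N f := by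
  rw [genMatrix_eq, LinearMap.toMatrix'_mulVec]
  rfl

section Expect

variable {p : Params} {N : ℕ} {μ : Measure (Config p.α N)}

theorem expect_initial (f : Config p.α N → ℝ) : expect p N μ 0 f = ∫ η, f η ∂μ := by
  simp [expect, transition, NormedSpace.exp_zero]

variable [IsProbabilityMeasure μ]

theorem expect_eq_sum (t : ℝ) (f : Config p.α N → ℝ) :
    expect p N μ t f = ∑ η, μ.real {η} * (transition p N t).mulVec f η := by
  rw [expect, integral_fintype (Integrable.of_finite)]
  simp only [smul_eq_mul]

theorem hasDerivAt_expect (f : Config p.α N → ℝ) (t : ℝ) :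
    HasDerivAt (fun s => expect p N μ s f) ((N : ℝ) ^ 2 * expect p N μ t (gen p N f)) t := by
  simp only [expect_eq_sum, Finset.mul_sum]
  refine HasDerivAt.fun_sum fun η _ => ?_
  have h := (hasDerivAt_exp_mulVec ((N : ℝ) ^ 2 • genMatrix p N) f t η).const_mul (μ.real {η})
  simp only [smul_smul] at h
  refine h.congr_deriv ?_
  rw [Matrix.smul_mulVec, genMatrix_mulVec, Matrix.mulVec_smul, Pi.smul_apply, smul_eq_mul,
    transition]
  ring

theorem expect_add (t : ℝ) (f g : Config p.α N → ℝ) :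
    expect p N μ t (fun η => f η + g η) = expect p N μ t f + expect p N μ t g := by
  simp only [expect_eq_sum, ← Finset.sum_add_distrib]
  refine Finset.sum_congr rfl fun η _ => ?_
  rw [← mul_add]
  congr 1
  exact congrFun (Matrix.mulVec_add _ f g) η

theorem expect_const_mul (t c : ℝ) (f : Config p.α N → ℝ) :
    expect p N μ t (fun η => c * f η) = c * expect p N μ t f := by
  simp only [expect_eq_sum, Finset.mul_sum]
  refine Finset.sum_congr rfl fun η _ => ?_
  rw [show (fun η => c * f η) = c • f from rfl, Matrix.mulVec_smul, Pi.smul_apply, smul_eq_mul]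
  ring

theorem expect_mul_const (t c : ℝ) (f : Config p.α N → ℝ) :
    expect p N μ t (fun η => f η * c) = expect p N μ t f * c := by
  simp only [mul_comm _ c, expect_const_mul]

theorem expect_neg (t : ℝ) (f : Config p.α N → ℝ) :
    expect p N μ t (fun η => -f η) = -expect p N μ t f := by
  rw [← neg_one_mul, ← expect_const_mul]
  simp only [neg_one_mul]

theorem expect_sub (t : ℝ) (f g : Config p.α N → ℝ) :
    expect p N μ t (fun η => f η - g η) = expect p N μ t f - expect p N μ t g := by
  simp only [sub_eq_add_neg, expect_add, expect_neg]

theorem abs_expect_initial_le {f : Config p.α N → ℝ} {M : ℝ} (h : ∀ η, |f η| ≤ M) :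
    |expect p N μ 0 f| ≤ M := by
  rw [expect_initial]
  have := norm_integral_le_of_norm_le_const (μ := μ) (f := f) (C := M) (Filter.Eventually.of_forall h)
  simpa using this

/-- The generator kills constants, so this expectation does not depend on time, and at time zero `μ`
is a probability measure. -/
theorem expect_const (t c : ℝ) : expect p N μ t (fun _ => c) = c := by
  have hgen : gen p N (fun _ => c) = fun _ => 0 := by
    ext η
    simp [gen, genBulk, genReservoir]
  have h0 : ∀ s, expect p N μ s (fun _ => 0) = 0 := fun s => by
    have := expect_const_mul (p := p) (N := N) (μ := μ) s 0 (fun _ => 0)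
    simpa using this
  have hd : ∀ s, HasDerivAt (fun s => expect p N μ s (fun _ => c)) 0 s := fun s =>
    (hasDerivAt_expect (μ := μ) (fun _ => c) s).congr_deriv (by rw [hgen, h0, mul_zero])
  have := is_const_of_deriv_eq_zero (fun s => (hd s).differentiableAt) (fun s => (hd s).deriv) t 0
  refine this.trans ?_
  rw [expect_initial]
  simp

theorem expect_extend (t : ℝ) (x : ℕ) :
    expect p N μ t (fun η => extend (occ η) x) = extend (density p N μ t) x := by
  by_cases hx : x ∈ Finset.Icc 1 (N - 1)
  · simp only [extend_of_mem _ hx, density]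
  · simp only [extend, dif_neg hx, expect_const]

theorem expect_drift (t : ℝ) (z : ℕ) :
    expect p N μ t (fun η => drift p N (extend (occ η)) z)
      = drift p N (extend (density p N μ t)) z := by
  simp only [drift, lap, diffLeft, diffRight]
  split_ifs <;>
    simp only [expect_const_mul, expect_add, expect_sub, expect_neg, expect_extend, expect_const]

theorem expect_pairSource (t : ℝ) (z w : ℕ) :
    expect p N μ t (fun η => pairSource p N (extend (occ η)) z w)
      = pairSource p N (extend (density p N μ t)) z w := by
  simp only [pairSource]
  split_ifs <;>
    simp only [expect_const_mul, expect_add, expect_extend, expect_const]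

theorem expect_pairGen (t : ℝ) (α : ℕ) (κL κR : ℝ) (F : Config p.α N → ℕ → ℕ → ℝ) (z w : ℕ) :
    expect p N μ t (fun η => pairGen α κL κR N (F η) z w)
      = pairGen α κL κR N (fun x y => expect p N μ t (fun η => F η x y)) z w := by
  simp only [pairGen, diffLeft, diffRight]
  split_ifs <;> simp only [expect_const_mul, expect_add, expect_sub, expect_neg]

theorem hasDerivAt_density (t : ℝ) {z : ℕ} (hz : z ∈ Finset.Icc 1 (N - 1)) :
    HasDerivAt (fun s => extend (density p N μ s) z)
      ((N : ℝ) ^ 2 * drift p N (extend (density p N μ t)) z) t := by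
  have h := hasDerivAt_expect (μ := μ) (fun η => occ η ⟨z, hz⟩) t
  rw [funext fun η => gen_occ p N η ⟨z, hz⟩, expect_drift] at h
  simpa only [extend_of_mem _ hz, density] using h

/-- The two-point function, completed on the diagonal by the duality function. -/
noncomputable def pairCorr (p : Params) (N : ℕ) (μ : Measure (Config p.α N)) (t : ℝ)
    (x y : ℕ) : ℝ :=
  expect p N μ t (fun η => pairDual p.α (extend (occ η)) x y)
    + -1 * (extend (density p N μ t) x * extend (density p N μ t) y)

/-- The duality function and the product of densities evolve by the same operator with the same
boundary source. Their difference keeps only the squared gradient, which comes from the product. -/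
theorem isPairFlow_pairCorr (hα : 1 ≤ p.α) (T : ℝ) :
    IsPairFlow p.α (killL p N) (killR p N) N T (pairCorr p N μ) fun s x y =>
      if y = x + 1 then -(extend (density p N μ s) (x + 1) - extend (density p N μ s) x) ^ 2
      else 0 := by
  intro s _ x y hxy
  obtain ⟨h1, h2, h3, -⟩ := mem_pairs.1 hxy
  have hx : x ∈ Finset.Icc 1 (N - 1) := Finset.mem_Icc.2 (by omega)
  have hy : y ∈ Finset.Icc 1 (N - 1) := Finset.mem_Icc.2 (by omega)
  have d1 := hasDerivAt_expect (μ := μ) (fun η => pairDual p.α (extend (occ η)) x y) s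
  have d2 := ((hasDerivAt_density (μ := μ) s hx).mul (hasDerivAt_density (μ := μ) s hy)).const_mul (-1)
  have hg : gen p N (fun η => pairDual p.α (extend (occ η)) x y) = fun η =>
      pairGen p.α (killL p N) (killR p N) N (pairDual p.α (extend (occ η))) x y
        + pairSource p N (extend (occ η)) x y := by
    ext η
    exact gen_pairDual p hα N η hxy
  rw [hg, expect_add, expect_pairGen, expect_pairSource] at d1
  refine (d1.add d2).congr_deriv ?_
  have hdr := drift_mul_add_mul_drift p N (extend (density p N μ s)) h1 h2 h3
  unfold pairCorr
  rw [pairGen_add, pairGen_const_mul]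
  by_cases h : y = x + 1
  · simp only [if_pos h] at hdr ⊢
    linear_combination -(N : ℝ) ^ 2 * hdr
  · simp only [if_neg h] at hdr ⊢
    linear_combination -(N : ℝ) ^ 2 * hdr

theorem corr_eq_pairCorr (t : ℝ) {x y : Site N} (hxy : x ≠ y) :
    corr p N μ t x y = pairCorr p N μ t x y := by
  have hne : ¬(x : ℕ) = y := fun e => hxy (Subtype.ext e)
  simp only [corr, pairCorr, pairDual, if_neg hne, extend_coe]
  have : ∀ η : Config p.α N, (occ η x - density p N μ t x) * (occ η y - density p N μ t y)
      = occ η x * occ η y - density p N μ t x * occ η y - density p N μ t y * occ η x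
        + density p N μ t x * density p N μ t y := fun η => by ring
  simp only [this, expect_add, expect_sub, expect_const_mul, expect_const]
  rw [show expect p N μ t (fun η => occ η x) = density p N μ t x from rfl,
    show expect p N μ t (fun η => occ η y) = density p N μ t y from rfl]
  ring

end Expect

end SEP

/-! ### Bounds on the density gradient and on the initial correlations. -/

namespace SEP

open Set MeasureTheory

variable {p : Params} {N : ℕ}

theorem killL_pos (hp : p.Admissible) (hN : 1 ≤ N) : 0 < killL p N :=
  div_pos hp.lamL_mem.1 (Real.rpow_pos_of_pos (by exact_mod_cast hN) _)

theorem killR_pos (hp : p.Admissible) (hN : 1 ≤ N) : 0 < killR p N :=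
  div_pos hp.lamR_mem.1 (Real.rpow_pos_of_pos (by exact_mod_cast hN) _)

/-- For `θ < 0` the difference `N^θ - λ^ℓ` may be negative, but it costs at most one unit of `λ^ℓ
λ^r`; what remains is at least `λ^ℓ λ^r (N - 2)`, and `N ≥ 3`. -/
theorem slope_denom_ge (hp : p.Admissible) (hN : 3 ≤ N) :
    p.lamL * p.lamR * N / 3 ≤ p.lamL * p.lamR * ((N : ℝ) - 1) + p.lamL * (N : ℝ) ^ p.θ
      + p.lamR * ((N : ℝ) ^ p.θ - p.lamL) := by
  have hN' : (3 : ℝ) ≤ N := by exact_mod_cast hN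
  have h1 := hp.lamL_mem.1
  have h2 := hp.lamR_mem.1
  have h3 : 0 < (N : ℝ) ^ p.θ := Real.rpow_pos_of_pos (by linarith) _
  have h4 : 0 < p.lamL * p.lamR := mul_pos h1 h2
  nlinarith [mul_pos h1 h3, mul_pos h2 h3]

theorem abs_slope_le (hp : p.Admissible) (hN : 3 ≤ N) :
    |slope p N| ≤ 3 * |p.rhoR - p.rhoL| / N := by
  have hN' : (3 : ℝ) ≤ N := by exact_mod_cast hN
  have h1 := hp.lamL_mem.1
  have h2 := hp.lamR_mem.1
  have hD := slope_denom_ge hp hN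
  have h4 : 0 < p.lamL * p.lamR := mul_pos h1 h2
  have hD0 : 0 < p.lamL * p.lamR * N / 3 := by positivity
  rw [slope, abs_div, abs_of_pos (hD0.trans_le hD), abs_mul, abs_of_pos h4]
  refine (div_le_div_of_nonneg_left (by positivity) hD0 hD).trans (le_of_eq ?_)
  field_simp

/-- The affine profile is stationary. -/
theorem drift_affine (hp : p.Admissible) (hN : 3 ≤ N) {z : ℕ} (hz : 1 ≤ z) :
    drift p N (fun x => slope p N * x + intercept p N) z = 0 := by
  have hN' : (3 : ℝ) ≤ N := by exact_mod_cast hN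
  have h1 := hp.lamL_mem.1
  have h2 := hp.lamR_mem.1
  have hD0 : 0 < p.lamL * p.lamR * N / 3 := by positivity
  have hD := (hD0.trans_le (slope_denom_ge hp hN)).ne'
  have h3 : 0 < (N : ℝ) ^ p.θ := Real.rpow_pos_of_pos (by linarith) _
  -- Balance of the bulk flux with the reservoir flux at the left end; `br` is its counterpart on
  -- the right.
  have bl : slope p N - killL p N * (slope p N + intercept p N - p.rhoL) = 0 := by
    simp only [slope, intercept, killL]
    generalize hD' : p.lamL * p.lamR * ((N : ℝ) - 1) + p.lamL * (N : ℝ) ^ p.θ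
      + p.lamR * ((N : ℝ) ^ p.θ - p.lamL) = D at hD
    field_simp
    rw [← hD']
    ring
  have br : -slope p N - killR p N * (slope p N * (N - 1) + intercept p N - p.rhoR) = 0 := by
    simp only [slope, intercept, killR]
    generalize hD' : p.lamL * p.lamR * ((N : ℝ) - 1) + p.lamL * (N : ℝ) ^ p.θ
      + p.lamR * ((N : ℝ) ^ p.θ - p.lamL) = D at hD
    field_simp
    rw [← hD']
    ring
  simp only [drift, lap, diffLeft, diffRight]
  refine mul_eq_zero_of_right _ ?_
  have hl : (if z = 1 then -(killL p N * (slope p N * (z : ℝ) + intercept p N))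
      else slope p N * ((z - 1 : ℕ) : ℝ) + intercept p N - (slope p N * z + intercept p N))
      + (if z = 1 then killL p N * p.rhoL else 0) = -slope p N := by
    split_ifs with h
    · subst h; push_cast; linear_combination bl
    · rw [Nat.cast_sub hz]; push_cast; ring
  have hr : (if z + 1 = N then -(killR p N * (slope p N * (z : ℝ) + intercept p N))
      else slope p N * ((z + 1 : ℕ) : ℝ) + intercept p N - (slope p N * z + intercept p N))
      + (if z + 1 = N then killR p N * p.rhoR else 0) = slope p N := by
    split_ifs with h
    · have : (z : ℝ) = N - 1 := by rw [← h]; push_cast; ring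
      rw [this]; linear_combination br
    · push_cast; ring
  linarith

/-- The difference between the density and its stationary profile solves the heat equation. -/
theorem isHeat_density_sub (hp : p.Admissible) (hN : 3 ≤ N) (μ : Measure (Config p.α N))
    [IsProbabilityMeasure μ] :
    IsHeat (p.α * (N : ℝ) ^ 2) (killL p N) (killR p N) N
      fun s x => extend (density p N μ s) x - (slope p N * x + intercept p N) := by
  intro s x hx
  refine ((hasDerivAt_density (μ := μ) s hx).sub_const _).congr_deriv ?_
  have h0 := drift_affine hp hN (Finset.mem_Icc.1 hx).1
  have h1 : lap (killL p N) (killR p N) N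
      (fun x => extend (density p N μ s) x - (slope p N * x + intercept p N)) x
      = lap (killL p N) (killR p N) N (extend (density p N μ s)) x
        - lap (killL p N) (killR p N) N (fun x => slope p N * x + intercept p N) x := by
    simp only [lap, diffLeft, diffRight]
    split_ifs <;> ring
  rw [h1]
  simp only [drift] at h0 ⊢
  linear_combination (N : ℝ) ^ 2 * h0

/-- The discrete gradient of the density stays of order `1 / N`. -/
theorem abs_density_sub_le (hp : p.Admissible) (hN : 3 ≤ N) (μ : Measure (Config p.α N))
    [IsProbabilityMeasure μ] {g : ℝ → ℝ} {K A B : ℝ}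
    (hg : ∀ u ∈ Icc (0 : ℝ) 1, ∀ v ∈ Icc (0 : ℝ) 1, |g u - g v| ≤ K * |u - v|)
    (hg0 : g 0 = intercept p N) (hg1 : g 1 = N * slope p N + intercept p N)
    (hA : |slope p N| ≤ A / N)
    (hB : ∀ x : Site N, |density p N μ 0 x - g ((x : ℝ) / N)| ≤ B / N)
    {s : ℝ} (hs : 0 ≤ s) {x : ℕ} (hx : 1 ≤ x) (hxN : x + 2 ≤ N) :
    |extend (density p N μ s) (x + 1) - extend (density p N μ s) x|
      ≤ (A + 3 * (K + A) + 2 * (B + (K + A))) / N := by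
  have hN' : (3 : ℝ) ≤ N := by exact_mod_cast hN
  have hN0 : (0 : ℝ) < N := by linarith
  have hL := killL_pos hp (show 1 ≤ N by omega)
  have hR := killR_pos hp (show 1 ≤ N by omega)
  have hmemN : ∀ x : ℕ, x ≤ N → (x : ℝ) / N ∈ Icc (0 : ℝ) 1 := fun x hx =>
    ⟨by positivity, (div_le_one hN0).2 (by exact_mod_cast hx)⟩
  have hstep : ∀ x : ℕ, x + 1 ≤ N → |g ((x + 1 : ℕ) / N) - g (x / N)| ≤ K / N := by
    intro x hx
    refine (hg _ (hmemN _ hx) _ (hmemN x (by omega))).trans (le_of_eq ?_)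
    rw [show ((x + 1 : ℕ) : ℝ) / N - x / N = 1 / N by push_cast; ring,
      abs_of_pos (by positivity)]
    ring
  let e : ℕ → ℝ := fun x => g (x / N) - (slope p N * x + intercept p N)
  have he : ∀ x : ℕ, x + 1 ≤ N → |e (x + 1) - e x| ≤ (K + A) / N := by
    intro x hx
    have h1 := hstep x hx
    have h2 : e (x + 1) - e x = (g ((x + 1 : ℕ) / N) - g (x / N)) - slope p N := by
      simp only [e]; push_cast; ring
    rw [h2, add_div]
    exact (abs_sub _ _).trans (add_le_add h1 hA)
  have he0 : e 0 = 0 := by simp [e, hg0]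
  have heN : e N = 0 := by
    simp only [e]
    rw [div_self hN0.ne', hg1]; ring
  have he1 : |e 1| ≤ (K + A) / N := by
    have := he 0 (by omega)
    rwa [he0, sub_zero] at this
  have heN1 : ∀ x, x + 1 = N → |e x| ≤ (K + A) / N := by
    intro x hx
    have := he x hx.le
    rwa [hx, heN, zero_sub, abs_neg] at this
  have hKA : 0 ≤ (K + A) / N := (abs_nonneg _).trans he1
  -- The initial density is close to `g` in supremum norm only, so the deviation is split. The
  -- smooth part `d` has a small gradient, propagated by the gradient maximum principle; the rest is
  -- `O(1/N)` pointwise and stays so. Setting `d = 0` at the end sites costs `O(1/N)` because `e`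
  -- vanishes at `0` and `N`, and it makes the boundary fluxes `κ d` vanish even when `κ` is large.
  let d : ℕ → ℝ := fun x => if x = 1 ∨ x + 1 = N then 0 else e x
  have hde : ∀ x, |e x - d x| ≤ (K + A) / N := by
    intro x
    simp only [d]
    split_ifs with h
    · rw [sub_zero]
      rcases h with rfl | h
      · exact he1
      · exact heN1 x h
    · simpa using hKA
  obtain ⟨ψ, hψ, hψ0⟩ := exists_isHeat (p.α * (N : ℝ) ^ 2) (killL p N) (killR p N) N d
  have hc : 0 ≤ p.α * (N : ℝ) ^ 2 := by positivity
  have hgrad := hψ.abs_grad_le_of_initial_abs_le (by omega) hc hL.le hR.le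
    (M := 3 * ((K + A) / N)) (fun z hz => ?_) hs x (by omega)
  · have hrest := ((isHeat_density_sub hp hN μ).sub hψ).abs_le_of_initial_abs_le hc hL.le hR.le
      (M := B / N + (K + A) / N) ?_ (fun z hz => ?_) hs
    · have r1 := hrest x (Finset.mem_Icc.2 (by omega))
      have r2 := hrest (x + 1) (Finset.mem_Icc.2 (by omega))
      rw [grad, if_neg (by omega), if_neg (by omega)] at hgrad
      simp only [Pi.add_apply, Pi.smul_apply, smul_eq_mul] at r1 r2
      have e1 : (A + 3 * (K + A) + 2 * (B + (K + A))) / N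
          = A / N + 3 * ((K + A) / N) + 2 * (B / N + (K + A) / N) := by ring
      rw [e1]
      push_cast at r2
      rw [abs_le] at *
      constructor <;> linarith [hA.1, hA.2, hgrad.1, hgrad.2, r1.1, r1.2, r2.1, r2.2]
    · have := (abs_nonneg _).trans (hB ⟨1, Finset.mem_Icc.2 (by omega)⟩)
      linarith
    · have h1 := hB ⟨z, hz⟩
      have h2 := hde z
      simp only [Pi.add_apply, Pi.smul_apply, smul_eq_mul, hψ0 z hz, extend_of_mem _ hz]
      have h3 : density p N μ 0 ⟨z, hz⟩ - (slope p N * z + intercept p N) + -1 * d z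
          = (density p N μ 0 ⟨z, hz⟩ - g ((z : ℝ) / N)) + (e z - d z) := by
        simp only [e]; ring
      rw [h3]
      exact (abs_add_le _ _).trans (add_le_add h1 h2)
  · unfold grad
    split_ifs with h1 h2
    · rw [hψ0 1 (Finset.mem_Icc.2 (by omega))]
      simp only [d, true_or, if_true, mul_zero, abs_zero]
      positivity
    · rw [hψ0 z (Finset.mem_Icc.2 (by omega))]
      simp only [d, h2, or_true, if_true, mul_zero, neg_zero, abs_zero]
      positivity
    · rw [hψ0 z (Finset.mem_Icc.2 (by omega)), hψ0 (z + 1) (Finset.mem_Icc.2 (by omega))]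
      have a1 := hde z
      have a2 := hde (z + 1)
      have a3 := he z (by omega)
      rw [abs_le] at *
      constructor <;> linarith [a1.1, a1.2, a2.1, a2.2, a3.1, a3.2]

/-- The initial two-point function is of order `1 / N`, except at the two corners. -/
theorem abs_pairCorr_initial_le (hα : 1 ≤ p.α) (hN : 2 ≤ N) (μ : Measure (Config p.α N))
    [IsProbabilityMeasure μ] {K K' : ℝ}
    (h1 : ∀ x y : Site N, x ≠ y → |corr p N μ 0 x y| ≤ K / N)
    (h2 : ∀ x : Site N, (x : ℕ) ≠ 1 → (x : ℕ) ≠ N - 1 →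
      |expect p N μ 0 fun η =>
        p.α * (occ η x * (occ η x - 1)) - (p.α - 1) * density p N μ 0 x ^ 2| ≤ K' / N)
    {x y : ℕ} (hxy : (x, y) ∈ pairs p.α N) :
    |pairCorr p N μ 0 x y| ≤ (|K| + |K'| + ((p.α : ℝ) ^ 3 + (p.α : ℝ) ^ 2)) / N ∨
      (((x = 1 ∧ y = 1) ∨ (x = N - 1 ∧ y = N - 1)) ∧
        |pairCorr p N μ 0 x y| ≤ |K| + |K'| + ((p.α : ℝ) ^ 3 + (p.α : ℝ) ^ 2)) := by
  have hN0 : (0 : ℝ) < N := by exact_mod_cast (show 0 < N by omega)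
  obtain ⟨hx, hle, hy, hd⟩ := mem_pairs.1 hxy
  have hxm : x ∈ Finset.Icc 1 (N - 1) := Finset.mem_Icc.2 (by omega)
  have hym : y ∈ Finset.Icc 1 (N - 1) := Finset.mem_Icc.2 (by omega)
  have hα3 : 0 ≤ (p.α : ℝ) ^ 3 + (p.α : ℝ) ^ 2 := by positivity
  rcases eq_or_lt_of_le hle with e | hlt
  · subst e
    have hα2 : (2 : ℝ) ≤ p.α := by
      have := hd rfl
      exact_mod_cast (show 2 ≤ p.α by omega)
    have hα1 : (1 : ℝ) ≤ p.α - 1 := by linarith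
    have hα0 : (p.α : ℝ) - 1 ≠ 0 := by linarith
    -- No decay is assumed at the corners; boundedness of the occupations by `α` gives an estimate
    -- of order one.
    by_cases hc : x = 1 ∨ x = N - 1
    · right
      refine ⟨by omega, ?_⟩
      have hocc : ∀ η : Config p.α N, 0 ≤ occ η ⟨x, hxm⟩ ∧ occ η ⟨x, hxm⟩ ≤ p.α := fun η =>
        ⟨Nat.cast_nonneg _, by
          have := (η ⟨x, hxm⟩).2
          unfold occ
          exact_mod_cast (show (η ⟨x, hxm⟩ : ℕ) ≤ p.α by omega)⟩
      have b1 : |expect p N μ 0 (fun η => pairDual p.α (extend (occ η)) x x)| ≤ (p.α : ℝ) ^ 3 := by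
        refine abs_expect_initial_le fun η => ?_
        rw [pairDual, if_pos rfl, extend_of_mem _ hxm]
        obtain ⟨o1, o2⟩ := hocc η
        have o3 : |occ η ⟨x, hxm⟩ * (occ η ⟨x, hxm⟩ - 1)| ≤ (p.α : ℝ) ^ 2 := by
          rw [abs_mul, sq, abs_of_nonneg o1]
          refine mul_le_mul o2 (abs_le.2 ⟨by linarith, by linarith⟩) (abs_nonneg _) (by linarith)
        rw [abs_div, abs_mul, abs_of_pos (show (0 : ℝ) < p.α by linarith),
          abs_of_pos (show (0 : ℝ) < p.α - 1 by linarith)]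
        refine (div_le_self (by positivity) hα1).trans ?_
        rw [pow_succ']
        gcongr
      have b2 : |extend (density p N μ 0) x| ≤ p.α := by
        rw [extend_of_mem _ hxm, density]
        exact abs_expect_initial_le fun η => abs_le.2 ⟨by linarith [(hocc η).1], (hocc η).2⟩
      have b3 : |-1 * (extend (density p N μ 0) x * extend (density p N μ 0) x)| ≤ (p.α : ℝ) ^ 2 := by
        rw [abs_mul, abs_neg, abs_one, one_mul, abs_mul, sq]
        gcongr
      rw [pairCorr]
      refine (abs_add_le _ _).trans ?_
      linarith [abs_nonneg K, abs_nonneg K']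
    · left
      push Not at hc
      have := h2 ⟨x, hxm⟩ hc.1 hc.2
      rw [expect_sub, expect_const] at this
      have e1 : pairCorr p N μ 0 x x = (expect p N μ 0 (fun η =>
          p.α * (occ η ⟨x, hxm⟩ * (occ η ⟨x, hxm⟩ - 1)))
            - (p.α - 1) * density p N μ 0 ⟨x, hxm⟩ ^ 2) / (p.α - 1) := by
        simp only [pairCorr, pairDual, if_true, extend_of_mem _ hxm, div_eq_mul_inv,
          expect_mul_const]
        field_simp
        ring
      rw [e1, abs_div, abs_of_pos (show (0 : ℝ) < p.α - 1 by linarith)]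
      refine (div_le_self (abs_nonneg _) hα1).trans (this.trans ?_)
      gcongr
      linarith [abs_nonneg K, le_abs_self K']
  · left
    have hne : (⟨x, hxm⟩ : Site N) ≠ ⟨y, hym⟩ := fun e => hlt.ne (congrArg Subtype.val e)
    have := h1 _ _ hne
    rw [corr_eq_pairCorr _ hne] at this
    refine this.trans ?_
    gcongr
    linarith [abs_nonneg K', le_abs_self K]

end SEP

/-! ### Choice of scales and conclusion. -/

namespace SEP

open Set MeasureTheory Filter

theorem isLittleO_natCast_rpow {q : ℝ} (hq : q < -1) :
    (fun N : ℕ => (N : ℝ) ^ q) =o[atTop] fun N : ℕ => 1 / (N : ℝ) := by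
  refine Asymptotics.isLittleO_of_tendsto' ?_ ?_
  · filter_upwards [eventually_ge_atTop 1] with N hN h
    have : (0 : ℝ) < N := by exact_mod_cast hN
    exact absurd h (by positivity)
  · have h := (tendsto_rpow_neg_atTop (show 0 < -(q + 1) by linarith)).comp
      (tendsto_natCast_atTop_atTop (R := ℝ))
    refine h.congr' ?_
    filter_upwards [eventually_ge_atTop 1] with N hN
    have : (0 : ℝ) < N := by exact_mod_cast hN
    simp only [Function.comp, neg_neg]
    rw [Real.rpow_add this, Real.rpow_one, div_div_eq_mul_div, div_one]

/-- An intermediate scale `m ~ N ^ (3 / 4)`, at which the corner terms are negligible. -/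
theorem exists_scale {α N : ℕ} (hα : 1 ≤ α) (hN : 2 ≤ N) {t : ℝ} (ht : 0 < t) :
    ∃ m : ℕ, 1 ≤ m ∧ m < N ∧
      1 / (m : ℝ) + 2 * Real.exp (-(α * (N : ℝ) ^ 2 / (m : ℝ) ^ 2 * t))
        ≤ (2 + 4 / t ^ 2) * (N : ℝ) ^ (-(3 / 4) : ℝ) := by
  have hN1 : (1 : ℝ) < N := by exact_mod_cast (show 1 < N by omega)
  have hN0 : (0 : ℝ) < N := by linarith
  have ha : (1 : ℝ) ≤ α := by exact_mod_cast hα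
  -- Any exponent strictly between `1/2` and `1` would serve: above `1/2` so that `1/m²` is
  -- `o(1/N)`, below `1` so that `N²/m²` diverges and the exponential is negligible.
  set Y : ℝ := (N : ℝ) ^ (3 / 4 : ℝ) with hY
  have hY1 : 1 ≤ Y := Real.one_le_rpow hN1.le (by norm_num)
  have hY0 : 0 < Y := by linarith
  have hYN : Y < N := by
    have := Real.rpow_lt_rpow_of_exponent_lt hN1 (show (3 / 4 : ℝ) < 1 by norm_num)
    rwa [Real.rpow_one] at this
  have hm1 : 1 ≤ ⌊Y⌋₊ := Nat.one_le_floor_iff _ |>.2 hY1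
  have hmY : (⌊Y⌋₊ : ℝ) ≤ Y := Nat.floor_le hY0.le
  have hmY2 : Y / 2 ≤ ⌊Y⌋₊ := by
    have h1 := Nat.lt_floor_add_one Y
    have h2 : (1 : ℝ) ≤ ⌊Y⌋₊ := by exact_mod_cast hm1
    linarith
  have hm0 : (0 : ℝ) < ⌊Y⌋₊ := by exact_mod_cast hm1
  refine ⟨⌊Y⌋₊, hm1, by exact_mod_cast hmY.trans_lt hYN, ?_⟩
  have hneg : (N : ℝ) ^ (-(3 / 4) : ℝ) = 1 / Y := by
    rw [Real.rpow_neg hN0.le, one_div]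
  have h1 : 1 / (⌊Y⌋₊ : ℝ) ≤ 2 * (1 / Y) := by
    rw [mul_one_div, div_le_div_iff₀ hm0 hY0]; linarith
  have hY2 : Y ^ 2 * √N = (N : ℝ) ^ 2 := by
    rw [hY, ← Real.rpow_natCast, ← Real.rpow_mul hN0.le, Real.sqrt_eq_rpow, ← Real.rpow_add hN0,
      ← Real.rpow_natCast]
    norm_num
  have hs : √(N : ℝ) * t ≤ α * (N : ℝ) ^ 2 / (⌊Y⌋₊ : ℝ) ^ 2 * t := by
    refine mul_le_mul_of_nonneg_right ?_ ht.le
    rw [le_div_iff₀ (by positivity)]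
    have : (⌊Y⌋₊ : ℝ) ^ 2 ≤ Y ^ 2 := by gcongr
    have hsq : 0 ≤ √(N : ℝ) := Real.sqrt_nonneg _
    nlinarith [mul_le_mul_of_nonneg_left this hsq, sq_nonneg (N : ℝ)]
  have h2 : Real.exp (-(α * (N : ℝ) ^ 2 / (⌊Y⌋₊ : ℝ) ^ 2 * t)) ≤ 2 / (N * t ^ 2) := by
    have hst : 0 < √(N : ℝ) * t := mul_pos (Real.sqrt_pos.2 hN0) ht
    have h3 : (√(N : ℝ) * t) ^ 2 / 2 ≤ Real.exp (√(N : ℝ) * t) := by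
      have := Real.quadratic_le_exp_of_nonneg hst.le
      linarith
    rw [mul_pow, Real.sq_sqrt hN0.le] at h3
    calc _ ≤ Real.exp (-(√(N : ℝ) * t)) := Real.exp_le_exp.2 (by linarith)
      _ = 1 / Real.exp (√(N : ℝ) * t) := by rw [Real.exp_neg, one_div]
      _ ≤ 1 / (N * t ^ 2 / 2) := one_div_le_one_div_of_le (by positivity) h3
      _ = 2 / (N * t ^ 2) := by field_simp
  have h4 : 2 / (N * t ^ 2) ≤ 2 / t ^ 2 * (1 / Y) := by
    rw [div_mul_div_comm, mul_one, mul_comm (N : ℝ)]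
    gcongr
  rw [hneg]
  have e : (2 + 4 / t ^ 2) * (1 / Y) = 2 * (1 / Y) + 2 * (2 / t ^ 2 * (1 / Y)) := by ring
  linarith

/-- The elementary estimate that turns the bounds for the pair equation into an error term. -/
theorem boundary_bound {K G Λ ε t X Y E : ℝ} {N : ℝ} (hN : 0 < N) (hK : 0 ≤ K) (hG : 0 ≤ G)
    (hΛ : 0 ≤ Λ) (ht : 0 < t) (hε : 0 ≤ ε) (hE : 0 ≤ E) (hX : X ≤ ε * N + Λ * E)
    (hY0 : 0 ≤ Y) (hY : Y ≤ (1 + Λ) * N) :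
    K / N * (Real.exp 1 * (X / (N * √t))) + 2 * G / N ^ 3 * (X * Y)
      ≤ (Real.exp 1 * K + 2 * G * (1 + Λ)) * ((1 + 1 / √t) * (ε / N))
        + Λ * (Real.exp 1 * K / √t + 2 * G * (1 + Λ)) * (E / N ^ 2) := by
  have hs : 0 < √t := Real.sqrt_pos.2 ht
  have hXb : 0 ≤ ε * N + Λ * E := by positivity
  have h1 : K / N * (Real.exp 1 * (X / (N * √t)))
      ≤ K / N * (Real.exp 1 * ((ε * N + Λ * E) / (N * √t))) := by gcongr
  have h2 : 2 * G / N ^ 3 * (X * Y) ≤ 2 * G / N ^ 3 * ((ε * N + Λ * E) * ((1 + Λ) * N)) := by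
    gcongr
  refine (add_le_add h1 h2).trans ?_
  have e1 : K / N * (Real.exp 1 * ((ε * N + Λ * E) / (N * √t)))
      + 2 * G / N ^ 3 * ((ε * N + Λ * E) * ((1 + Λ) * N))
      = (Real.exp 1 * K * (1 / √t) + 2 * G * (1 + Λ)) * (ε / N)
        + Λ * (Real.exp 1 * K / √t + 2 * G * (1 + Λ)) * (E / N ^ 2) := by
    field_simp
  rw [e1]
  have h3 : 0 ≤ Real.exp 1 * K * (ε / N) := by positivity
  have h4 : 0 ≤ 2 * G * (1 + Λ) * (1 / √t) * (ε / N) := by positivity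
  linarith

theorem corr_comm (p : Params) (N : ℕ) (μ : Measure (Config p.α N)) (t : ℝ) (x y : Site N) :
    corr p N μ t x y = corr p N μ t y x := by
  simp only [corr, mul_comm]

end SEP

theorem proposition3p4 (p : SEP.Params) (hp : p.Admissible) (hθ : p.θ < 1)
    (T : ℝ) (hT : 0 < T)
    (μ : ∀ N : ℕ, MeasureTheory.Measure (SEP.Config p.α N))
    (hμ : ∀ N, MeasureTheory.IsProbabilityMeasure (μ N))
    (hreg : SEP.RegularInitialDensity p μ)
    (hcorr : SEP.InitialCorrDecay p μ) :
    ∃ C : ℝ, ∀ ε : ℝ, 0 < ε → ∀ t ∈ Set.Ioc (0 : ℝ) T,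
      ∃ r : ℕ → ℝ, (r =o[Filter.atTop] fun N : ℕ => 1 / (N : ℝ)) ∧
        ∀ N : ℕ, 1 ≤ N → ∀ x y : SEP.Site N, x ≠ y →
          (SEP.NearLeft ε x ∨ SEP.NearRight ε y) →
            |SEP.corr p N (μ N) t x y| ≤ C * ((1 + 1 / √t) * (ε / N)) + r N := by
  obtain ⟨g, hgC, ⟨K₁, hK₁⟩, hgb, ⟨K₂, hK₂⟩⟩ := hreg
  obtain ⟨⟨K₃, hK₃⟩, ⟨K₄, hK₄⟩⟩ := hcorr
  have hα := hp.one_le_α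
  have hl := hp.lamL_mem.1
  have hr := hp.lamR_mem.1
  set A : ℝ := 3 * |p.rhoR - p.rhoL|
  set G : ℝ := (A + 3 * (K₁ + A) + 2 * (K₂ + (K₁ + A))) ^ 2 with hG
  set K : ℝ := |K₃| + |K₄| + ((p.α : ℝ) ^ 3 + (p.α : ℝ) ^ 2) with hK
  set Λ : ℝ := 1 / p.lamL + 1 / p.lamR with hΛ
  have hG0 : 0 ≤ G := sq_nonneg _
  have hK0 : 0 ≤ K := by positivity
  have hΛ0 : 0 ≤ Λ := by positivity
  refine ⟨Real.exp 1 * K + 2 * G * (1 + Λ), fun ε hε t ht => ?_⟩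
  refine ⟨fun N => Λ * (Real.exp 1 * K / √t + 2 * G * (1 + Λ))
      * ((N : ℝ) ^ (p.θ - 2) + (N : ℝ) ^ (-2 : ℝ))
    + 2 * K * (2 + 4 / t ^ 2) ^ 2 * (N : ℝ) ^ (-(3 / 2) : ℝ), ?_, ?_⟩
  · exact (((SEP.isLittleO_natCast_rpow (by linarith)).add
      (SEP.isLittleO_natCast_rpow (by norm_num))).const_mul_left _).add
      ((SEP.isLittleO_natCast_rpow (by norm_num)).const_mul_left _)
  intro N hN1 x y hxy hnear
  have := hμ N
  have hxm := Finset.mem_Icc.1 x.2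
  have hym := Finset.mem_Icc.1 y.2
  have hne : (x : ℕ) ≠ y := fun e => hxy (Subtype.ext e)
  -- Two distinct sites exist only if `N - 1 ≥ 2`.
  have hN : 3 ≤ N := by omega
  have hN' : (3 : ℝ) ≤ N := by exact_mod_cast hN
  have hN0 : (0 : ℝ) < N := by linarith
  have hkL := SEP.killL_pos hp hN1
  have hkR := SEP.killR_pos hp hN1
  set E : ℝ := (N : ℝ) ^ p.θ with hE
  have hE0 : 0 < E := Real.rpow_pos_of_pos hN0 _
  have hEN : E ≤ N := by
    have := Real.rpow_le_rpow_of_exponent_le (show (1 : ℝ) ≤ N by linarith) hθ.le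
    rwa [Real.rpow_one] at this
  have hkL' : 1 / SEP.killL p N ≤ Λ * E := by
    rw [SEP.killL, one_div_div, ← hE, hΛ, add_mul, one_div_mul_eq_div]
    have : 0 < 1 / p.lamR * E := by positivity
    linarith
  have hkR' : 1 / SEP.killR p N ≤ Λ * E := by
    rw [SEP.killR, one_div_div, ← hE, hΛ, add_mul, one_div_mul_eq_div p.lamR]
    have : 0 < 1 / p.lamL * E := by positivity
    linarith
  have hΛE : Λ * E ≤ Λ * N := mul_le_mul_of_nonneg_left hEN hΛ0
  have hEpow : (E + 1) / (N : ℝ) ^ 2 = (N : ℝ) ^ (p.θ - 2) + (N : ℝ) ^ (-2 : ℝ) := by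
    rw [Real.rpow_sub hN0, Real.rpow_neg hN0.le, hE, Real.rpow_two, add_div, one_div]
  -- On the right `N - y` may exceed `ε N` by one; `Λ ≥ 1` lets this unit be absorbed by using `E +
  -- 1` in place of `E`, which produces the error `N ^ (-2)`.
  have hΛ1 : 1 ≤ Λ := by
    have h1 := one_le_one_div hl hp.lamL_mem.2
    have h2 : 0 < 1 / p.lamR := by positivity
    linarith
  have hgLip : ∀ u ∈ Set.Icc (0 : ℝ) 1, ∀ v ∈ Set.Icc (0 : ℝ) 1,
      |g N u - g N v| ≤ K₁ * |u - v| := fun u hu v hv =>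
    (convex_Icc (0 : ℝ) 1).norm_image_sub_le_of_norm_derivWithin_le
      ((hgC N hN1).differentiableOn (by norm_num)) (hK₁ N hN1) hv hu
  have hg0 : g N 0 = SEP.intercept p N := by
    have := hgb N hN1 0 (by simp) 0 (by norm_num)
    simpa using this
  have hg1 : g N 1 = N * SEP.slope p N + SEP.intercept p N := by
    have := hgb N hN1 1 (by simp) 0 (by norm_num)
    simpa using this
  have hflow := SEP.isPairFlow_pairCorr (p := p) (N := N) (μ := μ N) hα t
  have hsrc : ∀ s ∈ Set.Icc 0 t, ∀ x y, (x, y) ∈ SEP.pairs p.α N →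
      |if y = x + 1 then -(SEP.extend (SEP.density p N (μ N) s) (x + 1)
        - SEP.extend (SEP.density p N (μ N) s) x) ^ 2 else 0|
      ≤ if y = x + 1 then G / (N : ℝ) ^ 2 else 0 := by
    intro s hs x y hz
    obtain ⟨h1, h2, h3, -⟩ := SEP.mem_pairs.1 hz
    split_ifs with h
    · have := SEP.abs_density_sub_le hp hN (μ N) hgLip hg0 hg1 (SEP.abs_slope_le hp hN)
        (hK₂ N hN1) hs.1 h1 (by omega)
      rw [abs_neg, abs_pow, hG, ← div_pow]
      gcongr
    · simp
  have h0 : ∀ x y, (x, y) ∈ SEP.pairs p.α N → |SEP.pairCorr p N (μ N) 0 x y| ≤ K / N ∨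
      (((x = 1 ∧ y = 1) ∨ (x = N - 1 ∧ y = N - 1)) ∧ |SEP.pairCorr p N (μ N) 0 x y| ≤ K) :=
    fun x y hz => SEP.abs_pairCorr_initial_le hα (by omega) (μ N) (hK₃ N hN1) (hK₄ N hN1) hz
  obtain ⟨m, hm1, hmN, hm⟩ := SEP.exists_scale hα (show 2 ≤ N by omega) ht.1
  have hcorner : 2 * K * (1 / m + 2 * Real.exp (-(p.α * (N : ℝ) ^ 2 / (m : ℝ) ^ 2 * t))) ^ 2
      ≤ 2 * K * (2 + 4 / t ^ 2) ^ 2 * (N : ℝ) ^ (-(3 / 2) : ℝ) := by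
    have e : ((N : ℝ) ^ (-(3 / 4) : ℝ)) ^ 2 = (N : ℝ) ^ (-(3 / 2) : ℝ) := by
      rw [← Real.rpow_natCast, ← Real.rpow_mul hN0.le]; norm_num
    rw [← e, mul_assoc (2 * K), ← mul_pow]
    gcongr
  have main : ∀ a b : ℕ, (a, b) ∈ SEP.pairs p.α N →
      ((a : ℝ) ≤ ε * N ∨ (N : ℝ) - b ≤ ε * N + 1) →
      |SEP.pairCorr p N (μ N) t a b| ≤ (Real.exp 1 * K + 2 * G * (1 + Λ))
        * ((1 + 1 / √t) * (ε / N))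
        + (Λ * (Real.exp 1 * K / √t + 2 * G * (1 + Λ))
            * ((N : ℝ) ^ (p.θ - 2) + (N : ℝ) ^ (-2 : ℝ))
          + 2 * K * (2 + 4 / t ^ 2) ^ 2 * (N : ℝ) ^ (-(3 / 2) : ℝ)) := by
    intro a b hab hnear
    obtain ⟨h1, h2, h3, -⟩ := SEP.mem_pairs.1 hab
    have hbN : (b : ℝ) ≤ N := by exact_mod_cast (show b ≤ N by omega)
    have haN : (a : ℝ) ≤ N := by exact_mod_cast (show a ≤ N by omega)
    have hkL0 : 0 < 1 / SEP.killL p N := by positivity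
    have hkR0 : 0 < 1 / SEP.killR p N := by positivity
    have hb0 : (0 : ℝ) ≤ b := Nat.cast_nonneg b
    have ha0 : (0 : ℝ) ≤ a := Nat.cast_nonneg a
    rw [← hEpow]
    rcases hnear with h | h
    · have key := hflow.abs_le hα (by omega) hkL hkR ht.1 hG0 hK0 hsrc h0 hm1 hmN hab
      have := SEP.boundary_bound (X := a + 1 / SEP.killL p N) (Y := N - b + 1 / SEP.killR p N)
        (E := E + 1) hN0 hK0 hG0 hΛ0 ht.1 hε.le (by linarith) (by linarith) (by linarith) (by linarith)
      linarith
    · have key := hflow.abs_le_right hα (by omega) hkL hkR ht.1 hG0 hK0 hsrc h0 hm1 hmN hab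
      have := SEP.boundary_bound (X := N - b + 1 / SEP.killR p N) (Y := a + 1 / SEP.killL p N)
        (E := E + 1) hN0 hK0 hG0 hΛ0 ht.1 hε.le (by linarith) (by linarith) (by linarith) (by linarith)
      linarith
  have hleft : SEP.NearLeft ε x → (x : ℝ) ≤ ε * N := fun h => by
    unfold SEP.NearLeft at h
    linarith
  have hright : SEP.NearRight ε y → (N : ℝ) - y ≤ ε * N + 1 := fun h => by
    unfold SEP.NearRight at h
    linarith
  -- If `y < x` the pair is swapped: `y` is then in the left strip whenever `x` is, and `x` in the
  -- right strip whenever `y` is.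
  rcases lt_or_gt_of_ne hne with h | h
  · rw [SEP.corr_eq_pairCorr t hxy]
    exact main x y (SEP.mem_pairs.2 (by omega)) (hnear.imp hleft hright)
  · rw [SEP.corr_comm, SEP.corr_eq_pairCorr t hxy.symm]
    have h' : (y : ℝ) < x := by exact_mod_cast h
    exact main y x (SEP.mem_pairs.2 (by omega))
      (hnear.imp (fun e => h'.le.trans (hleft e)) fun e => by linarith [hright e])
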